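/- Conventions: rings and Hopf algebras are commutative. Let $K$ be a $\partial$-field (a field with a derivation $\partial$) containing $\mathbb{C}$, with $\partial|_{\mathbb{C}}=0$; e.g. $K=\mathbb{C}(t)$ with $\partial=d/dt$. A $\partial$-$K$-algebra ($\partial$-$K$-Hopf algebra) is a $K$-algebra ($K$-Hopf algebra) with an additive operator $\partial$ that satisfies the Leibniz rule, extends $\partial$ of $K$, and (for Hopf algebras) commutes with the coproduct, counit and antipode; here $\partial(x\otimes y)=\partial x\otimes y+x\otimes\partial y$. Let $\mathsf{G}_0^\circ=\operatorname{Spec}J_0$ be a connected affine algebraic $\mathbb{C}$-group and $\Gamma$ a finite group acting on it by group automorphisms; e.g. the adjoint simple group of a complex simple Lie algebra and the automorphism group of its Dynkin diagram. Let $\mathsf{G}_0=\mathsf{G}_0^\circ\rtimes\Gamma=\operatorname{Spec}H_0$, let $H=K\otimes_{\mathbb{C}}H_0$ with $\partial(x\otimes h)=\partial x\otimes h$, and let $\mathsf{G}=\operatorname{Spec}_\partial(H)$. Let $\mathsf{X}=\operatorname{Spec}_\partial(B)$ be a right $\partial$-$K$-torsor for $\mathsf{G}$, i.e. $B\neq0$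 is a $\partial$-$K$-algebra with an $H$-comodule structure $\rho:B\to B\otimes_KH$ by a morphism of $\partial$-$K$-algebras such that $B\otimes_KB\to B\otimes_KH$, $b\otimes c\mapsto b\rho(c)$, is bijective. Let $(H',\lambda)$, $H'=H^B$, $\mathsf{G}^{\mathsf{X}}=\operatorname{Spec}_\partial(H')$, be the pair (unique up to isomorphism) of a $\partial$-$K$-Hopf algebra $H'$ and a morphism $\lambda:B\to H'\otimes_KB$ of $\partial$-$K$-algebras that makes $B$ a left $H'$-comodule, commutes with $\rho$, i.e. $(\lambda\otimes\mathrm{id})\rho=(\mathrm{id}\otimes\rho)\lambda$, and is such that $B\otimes_KB\to H'\otimes_KB$, $b\otimes c\mapsto\lambda(b)(1\otimes c)$, is bijective. For an affine $\partial$-$K$-group $\operatorname{Spec}_\partial(A)$ with counit $\epsilon$, its Lie algebra is the $\partial$-$K$-Lie algebra $\operatorname{Lie}(\operatorname{Spec}_\partial A)=\operatorname{Der}_\epsilon(A,K)$ with $(\partial D)(a)=\partial(D(a))-D(\partial a)$; put $\mathfrak{g}^{\mathsf{X}}=\operatorname{Lie}(\mathsf{G}^{\mathsf{X}})$. **Proposition.**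 There is a $\partial$-$K$-Hopf subalgebra $Z'$ of $H'$, finite-dimensional over $K$, with the following properties, where $J':=H'/(Z'^+)$ is the quotient $\partial$-$K$-Hopf algebra by the ideal generated by $Z'^+=\operatorname{Ker}(\epsilon:Z'\to K)$: 1. $Z'$ is separable as a $K$-algebra; 2. $\pi_0(J')=K$, i.e. $J'$ contains no finite-dimensional separable $K$-subalgebra other than $K$; 3. $\operatorname{Spec}(J')\to\operatorname{Spec}(H')$ is an open immersion whose image is the connected component of the identity element, i.e. $\operatorname{Spec}(J')$ is the identity component of $\mathsf{G}^{\mathsf{X}}$; 4. composition with $H'\to J'$ is an isomorphism $\operatorname{Lie}(\operatorname{Spec}_\partial(J'))\cong\mathfrak{g}^{\mathsf{X}}$ of $\partial$-$K$-Lie algebras. -/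

import Mathlib

open scoped TensorProduct Differential

noncomputable section

namespace DiffTorsor

/-! ### Differential structures on tensor products -/

section TensorDeriv

variable {K A B : Type*} [CommRing K] [Differential K]
  [CommRing A] [Algebra K A] [Differential A] [DifferentialAlgebra K A]
  [CommRing B] [Algebra K B] [Differential B] [DifferentialAlgebra K B]

theorem deriv_smul (c : K) (a : A) : (c • a)′ = c′ • a + c • a′ := by
  simp only [Algebra.smul_def, Derivation.leibniz, deriv_algebraMap, Algebra.algebraMap_self,
    RingHom.id_apply]
  ring

variable (K A B) in
/-- The additive operator `a ⊗ b ↦ a′ ⊗ b + a ⊗ b′` on `A ⊗[K] B`. -/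
def tensorDeriv : A ⊗[K] B →+ A ⊗[K] B :=
  TensorProduct.liftAddHom
    (AddMonoidHom.mk' (fun a => AddMonoidHom.mk' (fun b => a′ ⊗ₜ[K] b + a ⊗ₜ[K] b′)
        (fun b c => by simp only [map_add, TensorProduct.tmul_add]; abel))
      (fun a c => by
        ext b
        simp only [AddMonoidHom.mk'_apply, AddMonoidHom.add_apply, map_add,
          TensorProduct.add_tmul]
        abel))
    (fun r a b => by
      simp only [AddMonoidHom.mk'_apply, deriv_smul, TensorProduct.add_tmul,
        TensorProduct.tmul_add, TensorProduct.smul_tmul]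
      abel)

@[simp] theorem tensorDeriv_tmul (a : A) (b : B) :
    tensorDeriv K A B (a ⊗ₜ[K] b) = a′ ⊗ₜ[K] b + a ⊗ₜ[K] b′ := rfl

/-- The tensor product of two `∂`-`K`-algebras is a `∂`-ring, with
`∂(a ⊗ b) = ∂a ⊗ b + a ⊗ ∂b`. -/
instance instDifferentialTensor : Differential (A ⊗[K] B) where
  deriv := Derivation.mk' (tensorDeriv K A B).toIntLinearMap (by
    intro x y
    simp only [AddMonoidHom.coe_toIntLinearMap, smul_eq_mul]
    induction x using TensorProduct.induction_on with
    | zero => simp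
    | add x₁ x₂ h₁ h₂ => simp only [add_mul, map_add, mul_add, h₁, h₂]; abel
    | tmul a b =>
      induction y using TensorProduct.induction_on with
      | zero => simp
      | add y₁ y₂ h₁ h₂ => simp only [add_mul, map_add, mul_add, h₁, h₂]; abel
      | tmul c d =>
        simp only [Algebra.TensorProduct.tmul_mul_tmul, tensorDeriv_tmul, Derivation.leibniz,
          smul_eq_mul, TensorProduct.add_tmul, TensorProduct.tmul_add, mul_add]
        rw [mul_comm a (c′), mul_comm b (d′), mul_comm c (a′), mul_comm d (b′),
          mul_comm d b, mul_comm c a, mul_comm (c′) a, mul_comm (d′) b]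
        abel)

@[simp] theorem deriv_tmul (a : A) (b : B) :
    (a ⊗ₜ[K] b : A ⊗[K] B)′ = a′ ⊗ₜ[K] b + a ⊗ₜ[K] b′ := rfl

instance instDifferentialAlgebraTensor : DifferentialAlgebra K (A ⊗[K] B) where
  deriv_algebraMap c := by
    simp only [Algebra.TensorProduct.algebraMap_apply, deriv_tmul, deriv_algebraMap,
      Derivation.map_one_eq_zero, TensorProduct.tmul_zero, add_zero]

end TensorDeriv

/-! ### Base extension of an object over a ring of constants -/

/-- `∂` vanishes on (the image of) `k` in `K`. -/
class ConstantBase (k K : Type*) [CommRing k] [CommRing K] [Algebra k K] [Differential K] :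
    Prop where
  deriv_eq_zero : ∀ c : k, (algebraMap k K c)′ = 0

section BaseExt

variable {k K A : Type*} [CommRing k] [CommRing K] [Differential K] [Algebra k K]
  [ConstantBase k K] [CommRing A] [Algebra k A]

variable (k K) in
/-- The derivation of `K` as a `k`-linear map. -/
def constLinearDeriv : K →ₗ[k] K where
  toFun x := (x′)
  map_add' x y := map_add _ x y
  map_smul' c x := by
    simp [Algebra.smul_def, Derivation.leibniz, ConstantBase.deriv_eq_zero]

/-- `K ⊗[k] A` with the operator `x ⊗ a ↦ x′ ⊗ a`. -/
instance instDifferentialBaseExt : Differential (K ⊗[k] A) where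
  deriv := Derivation.mk'
    (((constLinearDeriv k K).rTensor A).toAddMonoidHom.toIntLinearMap) (by
    intro x y
    simp only [AddMonoidHom.coe_toIntLinearMap, smul_eq_mul, LinearMap.toAddMonoidHom_coe]
    induction x using TensorProduct.induction_on with
    | zero => simp
    | add x₁ x₂ h₁ h₂ => simp only [add_mul, map_add, mul_add, h₁, h₂]; abel
    | tmul a b =>
      induction y using TensorProduct.induction_on with
      | zero => simp
      | add y₁ y₂ h₁ h₂ => simp only [add_mul, map_add, mul_add, h₁, h₂]; abel
      | tmul c d =>
        simp only [Algebra.TensorProduct.tmul_mul_tmul, LinearMap.rTensor_tmul, constLinearDeriv,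
          LinearMap.coe_mk, AddHom.coe_mk, Derivation.leibniz, smul_eq_mul,
          TensorProduct.add_tmul]
        rw [mul_comm d b])

@[simp] theorem deriv_baseExt_tmul (x : K) (a : A) :
    (x ⊗ₜ[k] a : K ⊗[k] A)′ = x′ ⊗ₜ[k] a := rfl

instance instDifferentialAlgebraBaseExt : DifferentialAlgebra K (K ⊗[k] A) where
  deriv_algebraMap c := by
    simp only [Algebra.TensorProduct.algebraMap_apply, deriv_baseExt_tmul, Algebra.algebraMap_self,
      RingHom.id_apply]

end BaseExt

/-! ### `∂`-`K`-Hopf algebras -/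

/-- The structure maps of the `K`-Hopf algebra `H` commute with `∂`. -/
class DiffHopfAlgebra (K H : Type*) [CommRing K] [Differential K] [CommRing H]
    [HopfAlgebra K H] [Differential H] [DifferentialAlgebra K H] : Prop where
  comul_deriv : ∀ h : H, Coalgebra.comul (R := K) (h′) = ((Coalgebra.comul (R := K) h)′)
  counit_deriv : ∀ h : H, Coalgebra.counit (R := K) (h′) = ((Coalgebra.counit (R := K) h)′)
  antipode_deriv : ∀ h : H, HopfAlgebra.antipode K (h′) = ((HopfAlgebra.antipode K h)′)

instance instDiffHopfAlgebraBaseExt {k K A : Type*} [CommRing k] [CommRing K] [Differential K]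
    [Algebra k K] [ConstantBase k K] [CommRing A] [HopfAlgebra k A] :
    DiffHopfAlgebra K (K ⊗[k] A) where
  comul_deriv h := by
    induction h using TensorProduct.induction_on with
    | zero => simp
    | add x y hx hy => simp only [map_add, hx, hy]
    | tmul x a =>
      rw [deriv_baseExt_tmul, TensorProduct.comul_tmul, TensorProduct.comul_tmul]
      generalize Coalgebra.comul (R := k) a = y
      induction y using TensorProduct.induction_on with
      | zero => simp
      | add x y hx hy => simp only [TensorProduct.tmul_add, map_add, hx, hy]
      | tmul b c => simp
  counit_deriv h := by
    induction h using TensorProduct.induction_on with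
    | zero => simp
    | add x y hx hy => simp only [map_add, hx, hy]
    | tmul x a =>
      simp [Algebra.smul_def, Derivation.leibniz, ConstantBase.deriv_eq_zero]
  antipode_deriv h := by
    induction h using TensorProduct.induction_on with
    | zero => simp
    | add x y hx hy => simp only [map_add, hx, hy]
    | tmul x a => simp

/-! ### Semi-direct products of affine groups with finite groups -/

/-- A left action of the group `Γ` on `J` by Hopf algebra automorphisms; equivalently, a left
action of `Γ` by group automorphisms on the affine group `N = Spec J`, where
`(γ • a)(n) = a(γ⁻¹ n)` for `a ∈ J`. -/
structure HopfAction (k Γ J : Type*) [CommRing k] [Group Γ] [CommRing J] [HopfAlgebra k J] where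
  toHom : Γ →* (J ≃ₐ[k] J)
  counit_apply : ∀ γ a, Coalgebra.counit (R := k) (toHom γ a) = Coalgebra.counit (R := k) a
  comul_apply : ∀ γ a, Coalgebra.comul (R := k) (toHom γ a) =
    TensorProduct.map (toHom γ).toLinearMap (toHom γ).toLinearMap (Coalgebra.comul (R := k) a)

/-- The coordinate ring of `N ⋊ Γ`, where `N = Spec J`: since the underlying scheme is `N × Γ`,
it is the ring of families `f = (f_γ)` of elements of `J`, with `f(n, γ) = f_γ(n)`. -/
def SemidirectCoord {k Γ J : Type*} [CommRing k] [Group Γ] [CommRing J] [HopfAlgebra k J]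
    (_φ : HopfAction k Γ J) : Type _ := Γ → J

namespace SemidirectCoord

variable {k Γ J : Type*} [CommRing k] [Group Γ] [CommRing J] [HopfAlgebra k J]
  (φ : HopfAction k Γ J)

instance : CommRing (SemidirectCoord φ) := inferInstanceAs (CommRing (Γ → J))

instance : Algebra k (SemidirectCoord φ) := inferInstanceAs (Algebra k (Γ → J))

/-- Restriction of a function on `N ⋊ Γ` to the component `N × {γ}`. -/
def ev (γ : Γ) : SemidirectCoord φ →ₐ[k] J := Pi.evalAlgHom k (fun _ : Γ => J) γ

theorem comul_comp_toHom (g : Γ) : Coalgebra.comul (R := k) ∘ₗ (φ.toHom g).toLinearMap =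
    TensorProduct.map (φ.toHom g).toLinearMap (φ.toHom g).toLinearMap ∘ₗ
      Coalgebra.comul (R := k) := LinearMap.ext fun a => φ.comul_apply g a

theorem counit_comp_toHom (g : Γ) : Coalgebra.counit (R := k) ∘ₗ (φ.toHom g).toLinearMap =
    Coalgebra.counit (R := k) := LinearMap.ext fun a => φ.counit_apply g a

variable [Fintype Γ] [DecidableEq Γ]

/-- Functions on `(N × Γ) × (N × Γ)` are families of functions on `N × N`. -/
def tensorEquiv : SemidirectCoord φ ⊗[k] SemidirectCoord φ ≃ₐ[k] (Γ → Γ → J ⊗[k] J) :=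
  (Algebra.TensorProduct.comm k (Γ → J) (Γ → J)).trans <|
  (Algebra.TensorProduct.piRight k k (Γ → J) (fun _ : Γ => J)).trans <|
  AlgEquiv.piCongrRight fun _ =>
    (Algebra.TensorProduct.comm k (Γ → J) J).trans <|
    Algebra.TensorProduct.piRight k k J (fun _ : Γ => J)

theorem tensorEquiv_apply (x : SemidirectCoord φ ⊗[k] SemidirectCoord φ) (γ γ' : Γ) :
    tensorEquiv φ x γ γ' = TensorProduct.map (ev φ γ).toLinearMap (ev φ γ').toLinearMap x := by
  induction x using TensorProduct.induction_on with
  | zero => simp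
  | add x y hx hy => simp only [map_add, Pi.add_apply, hx, hy]
  | tmul a b => rfl

/-- From the multiplication `(n, γ)(n', γ') = (n · γ(n'), γγ')`:
`(Δ f)((n, γ), (n', γ')) = f_{γγ'}(n · γ(n'))`. -/
def comulHom : SemidirectCoord φ →ₐ[k] SemidirectCoord φ ⊗[k] SemidirectCoord φ :=
  (tensorEquiv φ).symm.toAlgHom.comp <|
    AlgHom.pi fun γ => AlgHom.pi fun γ' =>
      ((Algebra.TensorProduct.map (AlgHom.id k J) (φ.toHom γ⁻¹).toAlgHom).comp
        (Bialgebra.comulAlgHom k J)).comp (ev φ (γ * γ'))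

/-- Evaluation at the identity element `(1, 1)`. -/
def counitHom : SemidirectCoord φ →ₐ[k] k := (Bialgebra.counitAlgHom k J).comp (ev φ 1)

/-- From `(n, γ)⁻¹ = (γ⁻¹(n⁻¹), γ⁻¹)`: `(S f)(n, γ) = f_{γ⁻¹}(γ⁻¹(n⁻¹))`. -/
def antipodeMap : SemidirectCoord φ →ₗ[k] SemidirectCoord φ :=
  LinearMap.pi fun γ =>
    HopfAlgebra.antipode k ∘ₗ (φ.toHom γ).toLinearMap ∘ₗ (ev φ γ⁻¹).toLinearMap

theorem map_ev_comulHom (γ γ' : Γ) :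
    TensorProduct.map (ev φ γ).toLinearMap (ev φ γ').toLinearMap ∘ₗ (comulHom φ).toLinearMap =
      TensorProduct.map LinearMap.id (φ.toHom γ⁻¹).toLinearMap ∘ₗ
        Coalgebra.comul (R := k) ∘ₗ (ev φ (γ * γ')).toLinearMap := by
  refine LinearMap.ext fun f => ?_
  refine (tensorEquiv_apply φ _ γ γ').symm.trans ?_
  exact congrFun (congrFun ((tensorEquiv φ).apply_symm_apply _) γ) γ'

theorem ext_left {M : Type*} [AddCommGroup M] [Module k M] {x y : SemidirectCoord φ ⊗[k] M}
    (h : ∀ γ, (ev φ γ).toLinearMap.rTensor M x = (ev φ γ).toLinearMap.rTensor M y) : x = y := by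
  let E : SemidirectCoord φ ⊗[k] M ≃ₗ[k] (Γ → M ⊗[k] J) :=
    (TensorProduct.comm k (Γ → J) M).trans (TensorProduct.piRight k k M (fun _ : Γ => J))
  have hE : ∀ (z : SemidirectCoord φ ⊗[k] M) (γ : Γ),
      E z γ = TensorProduct.comm k J M ((ev φ γ).toLinearMap.rTensor M z) := by
    intro z γ
    induction z using TensorProduct.induction_on with
    | zero => simp
    | add x y hx hy => simp only [map_add, Pi.add_apply, hx, hy]
    | tmul a b => rfl
  apply E.injective
  funext γ
  rw [hE, hE, h]

theorem ext_tensor₃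
    {x y : SemidirectCoord φ ⊗[k] (SemidirectCoord φ ⊗[k] SemidirectCoord φ)}
    (h : ∀ α β γ, TensorProduct.map (ev φ α).toLinearMap
        (TensorProduct.map (ev φ β).toLinearMap (ev φ γ).toLinearMap) x =
      TensorProduct.map (ev φ α).toLinearMap
        (TensorProduct.map (ev φ β).toLinearMap (ev φ γ).toLinearMap) y) : x = y := by
  have key : ∀ (α β γ : Γ),
      (ev φ γ).toLinearMap.rTensor _ ∘ₗ (TensorProduct.comm k _ _).toLinearMap ∘ₗ
        (TensorProduct.assoc k _ _ _).symm.toLinearMap ∘ₗ (ev φ β).toLinearMap.rTensor _ ∘ₗ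
        (TensorProduct.leftComm k _ _ _).toLinearMap ∘ₗ (ev φ α).toLinearMap.rTensor _ =
      (TensorProduct.comm k _ _).toLinearMap ∘ₗ (TensorProduct.assoc k _ _ _).symm.toLinearMap ∘ₗ
        (TensorProduct.leftComm k _ _ _).toLinearMap ∘ₗ
        TensorProduct.map (ev φ α).toLinearMap
          (TensorProduct.map (ev φ β).toLinearMap (ev φ γ).toLinearMap) := fun α β γ => by
    ext a b c; rfl
  refine ext_left φ fun α => (TensorProduct.leftComm k _ _ _).injective ?_
  refine ext_left φ fun β => (TensorProduct.assoc k _ _ _).symm.injective ?_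
  refine (TensorProduct.comm k _ _).injective (ext_left φ fun γ => ?_)
  have hx := LinearMap.congr_fun (key α β γ) x
  have hy := LinearMap.congr_fun (key α β γ) y
  simp only [LinearMap.comp_apply, LinearEquiv.coe_coe] at hx hy
  rw [hx, hy, h]

theorem coassoc :
    (TensorProduct.assoc k _ _ _).toLinearMap ∘ₗ
      (comulHom φ).toLinearMap.rTensor _ ∘ₗ (comulHom φ).toLinearMap =
    (comulHom φ).toLinearMap.lTensor _ ∘ₗ (comulHom φ).toLinearMap := by
  refine LinearMap.ext fun f => ext_tensor₃ φ fun α β γ => ?_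
  have hmul : (φ.toHom (α * β)⁻¹).toLinearMap =
      (φ.toHom β⁻¹).toLinearMap ∘ₗ (φ.toHom α⁻¹).toLinearMap := by
    rw [mul_inv_rev, map_mul]; rfl
  have e1 := map_ev_comulHom φ α β
  have e2 := map_ev_comulHom φ (α * β) γ
  have e3 := map_ev_comulHom φ β γ
  have e4 := map_ev_comulHom φ α (β * γ)
  have nat : ∀ z : (SemidirectCoord φ ⊗[k] SemidirectCoord φ) ⊗[k] SemidirectCoord φ,
      TensorProduct.map (ev φ α).toLinearMap
        (TensorProduct.map (ev φ β).toLinearMap (ev φ γ).toLinearMap)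
        (TensorProduct.assoc k _ _ _ z) =
      TensorProduct.assoc k _ _ _ (TensorProduct.map
        (TensorProduct.map (ev φ α).toLinearMap (ev φ β).toLinearMap) (ev φ γ).toLinearMap z) := by
    intro z
    rw [← LinearEquiv.coe_coe, ← LinearEquiv.coe_coe, ← LinearMap.comp_apply,
      ← LinearMap.comp_apply]
    congr 1
    ext a b c; rfl
  have h1 : TensorProduct.map (TensorProduct.map (ev φ α).toLinearMap (ev φ β).toLinearMap)
        (ev φ γ).toLinearMap ∘ₗ (comulHom φ).toLinearMap.rTensor _ =
      TensorProduct.map (TensorProduct.map LinearMap.id (φ.toHom α⁻¹).toLinearMap ∘ₗ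
        Coalgebra.comul (R := k)) LinearMap.id ∘ₗ
        TensorProduct.map (ev φ (α * β)).toLinearMap (ev φ γ).toLinearMap := by
    rw [LinearMap.map_comp_rTensor, e1, ← TensorProduct.map_comp, LinearMap.id_comp,
      LinearMap.comp_assoc]
  have h2 : TensorProduct.map (ev φ α).toLinearMap
        (TensorProduct.map (ev φ β).toLinearMap (ev φ γ).toLinearMap) ∘ₗ
          (comulHom φ).toLinearMap.lTensor _ =
      TensorProduct.map LinearMap.id (TensorProduct.map LinearMap.id (φ.toHom β⁻¹).toLinearMap ∘ₗ
        Coalgebra.comul (R := k)) ∘ₗ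
        TensorProduct.map (ev φ α).toLinearMap (ev φ (β * γ)).toLinearMap := by
    rw [LinearMap.map_comp_lTensor, e3, ← TensorProduct.map_comp, LinearMap.id_comp,
      LinearMap.comp_assoc]
  have E2 := LinearMap.congr_fun e2 f
  have E4 := LinearMap.congr_fun e4 f
  simp only [LinearMap.comp_apply] at E2 E4
  have H1 := fun z => LinearMap.congr_fun h1 z
  have H2 := fun z => LinearMap.congr_fun h2 z
  simp only [LinearMap.comp_apply] at H1 H2
  simp only [LinearMap.comp_apply, LinearEquiv.coe_coe]
  rw [nat, H1, H2, E2, E4, mul_assoc, hmul]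
  have co := Coalgebra.coassoc_apply (R := k) ((ev φ (α * (β * γ))).toLinearMap f)
  generalize Coalgebra.comul (R := k) ((ev φ (α * (β * γ))).toLinearMap f) = w at co ⊢
  have h3 : (TensorProduct.assoc k _ _ _).toLinearMap ∘ₗ
      TensorProduct.map (TensorProduct.map LinearMap.id (φ.toHom α⁻¹).toLinearMap ∘ₗ
        Coalgebra.comul (R := k)) LinearMap.id ∘ₗ TensorProduct.map LinearMap.id
          ((φ.toHom β⁻¹).toLinearMap ∘ₗ (φ.toHom α⁻¹).toLinearMap) =
      TensorProduct.map LinearMap.id (TensorProduct.map (φ.toHom α⁻¹).toLinearMap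
        ((φ.toHom β⁻¹).toLinearMap ∘ₗ (φ.toHom α⁻¹).toLinearMap)) ∘ₗ
      (TensorProduct.assoc k _ _ _).toLinearMap ∘ₗ
        (Coalgebra.comul (R := k) (A := J)).rTensor J := by
    ext a b
    simp only [TensorProduct.AlgebraTensorModule.curry_apply, LinearMap.restrictScalars_self,
      TensorProduct.curry_apply, LinearMap.comp_apply, TensorProduct.map_tmul,
      LinearMap.rTensor_tmul, LinearMap.id_apply]
    generalize Coalgebra.comul (R := k) a = v
    induction v using TensorProduct.induction_on with
    | zero => simp
    | add x y hx hy => simp only [map_add, TensorProduct.add_tmul, hx, hy]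
    | tmul c d => rfl
  have h4 : TensorProduct.map LinearMap.id
        (TensorProduct.map LinearMap.id (φ.toHom β⁻¹).toLinearMap ∘ₗ
          Coalgebra.comul (R := k)) ∘ₗ TensorProduct.map LinearMap.id (φ.toHom α⁻¹).toLinearMap =
      TensorProduct.map LinearMap.id (TensorProduct.map (φ.toHom α⁻¹).toLinearMap
        ((φ.toHom β⁻¹).toLinearMap ∘ₗ (φ.toHom α⁻¹).toLinearMap)) ∘ₗ
        (Coalgebra.comul (R := k) (A := J)).lTensor J := by
    rw [← TensorProduct.map_comp, LinearMap.comp_assoc, comul_comp_toHom, ← LinearMap.comp_assoc,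
      ← TensorProduct.map_comp, LinearMap.map_comp_lTensor]
    rfl
  have H3 := LinearMap.congr_fun h3 w
  have H4 := LinearMap.congr_fun h4 w
  simp only [LinearMap.comp_apply, LinearEquiv.coe_coe] at H3 H4
  rw [H3, H4, co]

theorem rTensor_counit :
    (counitHom φ).toLinearMap.rTensor _ ∘ₗ (comulHom φ).toLinearMap = TensorProduct.mk k _ _ 1 := by
  refine LinearMap.ext fun f => ?_
  apply (TensorProduct.lid k _).injective
  funext γ
  have key : ∀ z : SemidirectCoord φ ⊗[k] SemidirectCoord φ,
      ev φ γ (TensorProduct.lid k _ ((counitHom φ).toLinearMap.rTensor _ z)) =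
      TensorProduct.lid k _ ((Coalgebra.counit (R := k) (A := J)).rTensor _
        (TensorProduct.map (ev φ 1).toLinearMap (ev φ γ).toLinearMap z)) := by
    intro z
    induction z using TensorProduct.induction_on with
    | zero => simp
    | add x y hx hy => simp only [map_add, hx, hy]
    | tmul c d => rfl
  have e := LinearMap.congr_fun (map_ev_comulHom φ 1 γ) f
  simp only [LinearMap.comp_apply, inv_one, map_one, one_mul] at e
  refine (key _).trans ?_
  rw [e]
  have h1 : TensorProduct.map LinearMap.id ((1 : J ≃ₐ[k] J)).toLinearMap =
      (LinearMap.id : J ⊗[k] J →ₗ[k] J ⊗[k] J) := TensorProduct.map_id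
  rw [h1, LinearMap.id_apply, Coalgebra.rTensor_counit_comul]
  simp only [TensorProduct.lid_tmul, one_smul, TensorProduct.mk_apply]
  rfl

theorem lTensor_counit :
    (counitHom φ).toLinearMap.lTensor _ ∘ₗ (comulHom φ).toLinearMap =
      (TensorProduct.mk k _ _).flip 1 := by
  refine LinearMap.ext fun f => ?_
  apply (TensorProduct.rid k _).injective
  funext γ
  have key : ∀ z : SemidirectCoord φ ⊗[k] SemidirectCoord φ,
      ev φ γ (TensorProduct.rid k _ ((counitHom φ).toLinearMap.lTensor _ z)) =
      TensorProduct.rid k _ ((Coalgebra.counit (R := k) (A := J)).lTensor _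
        (TensorProduct.map (ev φ γ).toLinearMap (ev φ 1).toLinearMap z)) := by
    intro z
    induction z using TensorProduct.induction_on with
    | zero => simp
    | add x y hx hy => simp only [map_add, hx, hy]
    | tmul c d => rfl
  have e := LinearMap.congr_fun (map_ev_comulHom φ γ 1) f
  simp only [LinearMap.comp_apply, mul_one] at e
  refine (key _).trans ?_
  rw [e, ← LinearMap.lTensor_def, ← LinearMap.comp_apply, ← LinearMap.lTensor_comp,
    counit_comp_toHom, Coalgebra.lTensor_counit_comul]
  simp only [TensorProduct.rid_tmul, one_smul, LinearMap.flip_apply, TensorProduct.mk_apply]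
  rfl

/-- The `k`-bialgebra of the affine group `N ⋊ Γ`. -/
instance instBialgebra : Bialgebra k (SemidirectCoord φ) :=
  Bialgebra.ofAlgHom (comulHom φ) (counitHom φ)
    (AlgHom.toLinearMap_injective (coassoc φ))
    (AlgHom.toLinearMap_injective (rTensor_counit φ))
    (AlgHom.toLinearMap_injective (lTensor_counit φ))

/-- The `k`-Hopf algebra of the affine group `N ⋊ Γ`. -/
instance instHopfAlgebra : HopfAlgebra k (SemidirectCoord φ) where
  antipode := antipodeMap φ
  mul_antipode_rTensor_comul := by
    refine LinearMap.ext fun f => ?_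
    funext γ
    have key : ∀ z : SemidirectCoord φ ⊗[k] SemidirectCoord φ,
        ev φ γ (LinearMap.mul' k _ ((antipodeMap φ).rTensor _ z)) =
        LinearMap.mul' k J (TensorProduct.map (HopfAlgebra.antipode k ∘ₗ (φ.toHom γ).toLinearMap)
          LinearMap.id
          (TensorProduct.map (ev φ γ⁻¹).toLinearMap (ev φ γ).toLinearMap z)) := by
      intro z
      induction z using TensorProduct.induction_on with
      | zero => simp
      | add x y hx hy => simp only [map_add, hx, hy]
      | tmul c d => rfl
    have e := LinearMap.congr_fun (map_ev_comulHom φ γ⁻¹ γ) f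
    simp only [LinearMap.comp_apply, inv_mul_cancel, inv_inv] at e
    refine (key _).trans ?_
    have e' : TensorProduct.map (HopfAlgebra.antipode k ∘ₗ (φ.toHom γ).toLinearMap)
          (LinearMap.id : J →ₗ[k] J) ∘ₗ
          TensorProduct.map LinearMap.id (φ.toHom γ).toLinearMap ∘ₗ Coalgebra.comul (R := k) =
        (HopfAlgebra.antipode k).rTensor J ∘ₗ Coalgebra.comul (R := k) ∘ₗ
          (φ.toHom γ).toLinearMap := by
      rw [comul_comp_toHom, ← LinearMap.comp_assoc, ← LinearMap.comp_assoc,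
        ← TensorProduct.map_comp, LinearMap.rTensor_comp_map]
      rfl
    refine (congrArg _ (congrArg _ e)).trans ?_
    refine (congrArg _ (LinearMap.congr_fun e' (ev φ 1 f))).trans ?_
    refine (HopfAlgebra.mul_antipode_rTensor_comul_apply _).trans ?_
    exact congrArg _ (φ.counit_apply _ _)
  mul_antipode_lTensor_comul := by
    refine LinearMap.ext fun f => ?_
    funext γ
    have key : ∀ z : SemidirectCoord φ ⊗[k] SemidirectCoord φ,
        ev φ γ (LinearMap.mul' k _ ((antipodeMap φ).lTensor _ z)) =
        LinearMap.mul' k J (TensorProduct.map LinearMap.id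
          (HopfAlgebra.antipode k ∘ₗ (φ.toHom γ).toLinearMap)
          (TensorProduct.map (ev φ γ).toLinearMap (ev φ γ⁻¹).toLinearMap z)) := by
      intro z
      induction z using TensorProduct.induction_on with
      | zero => simp
      | add x y hx hy => simp only [map_add, hx, hy]
      | tmul c d => rfl
    have e := LinearMap.congr_fun (map_ev_comulHom φ γ γ⁻¹) f
    simp only [LinearMap.comp_apply, mul_inv_cancel] at e
    refine (key _).trans ?_
    have hinv : (φ.toHom γ).toLinearMap ∘ₗ (φ.toHom γ⁻¹).toLinearMap =
        (LinearMap.id : J →ₗ[k] J) := by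
      refine LinearMap.ext fun a => ?_
      change (φ.toHom γ * φ.toHom γ⁻¹) a = a
      rw [← map_mul, mul_inv_cancel, map_one]; rfl
    have e' : TensorProduct.map (LinearMap.id : J →ₗ[k] J)
          (HopfAlgebra.antipode k ∘ₗ (φ.toHom γ).toLinearMap) ∘ₗ
          TensorProduct.map LinearMap.id (φ.toHom γ⁻¹).toLinearMap =
        (HopfAlgebra.antipode k).lTensor J := by
      rw [← TensorProduct.map_comp, LinearMap.comp_assoc, hinv]
      rfl
    refine (congrArg _ (congrArg _ e)).trans ?_
    refine (congrArg _ (LinearMap.congr_fun e' _)).trans ?_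
    exact HopfAlgebra.mul_antipode_lTensor_comul_apply _

end SemidirectCoord

/-! ### Torsors and bi-torsors, in terms of their coordinate algebras -/

section Galois

variable (K : Type*) [CommRing K] [Differential K]
  {B H H' : Type*} [CommRing B] [Algebra K B] [Differential B] [DifferentialAlgebra K B]
  [CommRing H] [HopfAlgebra K H] [Differential H] [DifferentialAlgebra K H]
  [CommRing H'] [HopfAlgebra K H'] [Differential H'] [DifferentialAlgebra K H']

/-- `B ⊗ B → B ⊗ H`, `b ⊗ c ↦ b ρ(c)`. -/
def rightGaloisMap (ρ : B →ₐ[K] B ⊗[K] H) : B ⊗[K] B →ₐ[K] B ⊗[K] H :=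
  Algebra.TensorProduct.productMap Algebra.TensorProduct.includeLeft ρ

/-- `B ⊗ B → H' ⊗ B`, `b ⊗ c ↦ lam(b) c`. -/
def leftGaloisMap (lam : B →ₐ[K] H' ⊗[K] B) : B ⊗[K] B →ₐ[K] H' ⊗[K] B :=
  Algebra.TensorProduct.productMap lam Algebra.TensorProduct.includeRight

/-- `(B, ρ)` is a right `H`-Galois `∂`-`K`-algebra, i.e. `Spec B` is a right `∂`-`K`-torsor for
the affine `∂`-`K`-group `Spec H`. -/
structure IsRightGalois [DiffHopfAlgebra K H] (ρ : B →ₐ[K] B ⊗[K] H) : Prop where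
  nontrivial : Nontrivial B
  deriv_comm : ∀ b, ρ (b′) = ((ρ b)′)
  coassoc : ∀ b, TensorProduct.assoc K B H H (TensorProduct.map ρ.toLinearMap LinearMap.id (ρ b)) =
    TensorProduct.map LinearMap.id (Coalgebra.comul (R := K)) (ρ b)
  counit : ∀ b, TensorProduct.rid K B
    (TensorProduct.map LinearMap.id (Coalgebra.counit (R := K)) (ρ b)) = b
  bijective : Function.Bijective (rightGaloisMap K ρ)

/-- `(B, lam)` is a left `H'`-Galois `∂`-`K`-algebra, i.e. `Spec B` is a left `∂`-`K`-torsor for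
the affine `∂`-`K`-group `Spec H'`. -/
structure IsLeftGalois [DiffHopfAlgebra K H'] (lam : B →ₐ[K] H' ⊗[K] B) : Prop where
  nontrivial : Nontrivial B
  deriv_comm : ∀ b, lam (b′) = ((lam b)′)
  coassoc : ∀ b, TensorProduct.assoc K H' H' B
      (TensorProduct.map (Coalgebra.comul (R := K)) LinearMap.id (lam b)) =
    TensorProduct.map LinearMap.id lam.toLinearMap (lam b)
  counit : ∀ b, TensorProduct.lid K B
    (TensorProduct.map (Coalgebra.counit (R := K)) LinearMap.id (lam b)) = b
  bijective : Function.Bijective (leftGaloisMap K lam)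

/-- `(B, lam, ρ)` is an `(H', H)`-bi-Galois `∂`-`K`-algebra, i.e. `Spec B` is a `∂`-`K`-bi-torsor.
For a right `H`-Galois `∂`-`K`-algebra `(B, ρ)`, this is what defines the pair `(H', lam)`, up to
unique isomorphism; `H'` is denoted by `H^B`, and `Spec H'` by `G^X` for `G = Spec H` and
`X = Spec B`. -/
structure IsBiGalois [DiffHopfAlgebra K H] [DiffHopfAlgebra K H']
    (lam : B →ₐ[K] H' ⊗[K] B) (ρ : B →ₐ[K] B ⊗[K] H) : Prop where
  left : IsLeftGalois K lam
  right : IsRightGalois K ρ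
  comm : ∀ b, TensorProduct.assoc K H' B H
      (TensorProduct.map lam.toLinearMap LinearMap.id (ρ b)) =
    TensorProduct.map LinearMap.id ρ.toLinearMap (lam b)

end Galois

/-! ### Separable algebras and separable parts -/

/-- A finite-dimensional separable commutative algebra over the field `K`, i.e. a finite product of
finite separable field extensions of `K` (over a field this is the same as being étale). -/
def IsFiniteSeparable (K A : Type*) [Field K] [CommRing A] [Algebra K A] : Prop :=
  FiniteDimensional K A ∧ Algebra.Etale K A

/-- The separable part `π₀(A)` of `A`: the subalgebra generated by all the finite-dimensional
separable subalgebras. -/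
def separablePart (K A : Type*) [Field K] [CommRing A] [Algebra K A] : Subalgebra K A :=
  sSup {S : Subalgebra K A | IsFiniteSeparable K S}

/-! ### `∂`-`K`-Hopf subalgebras and the associated quotients -/

section HopfSub

set_option linter.unusedSectionVars false

variable (K H : Type*) [CommRing K] [Differential K] [CommRing H] [HopfAlgebra K H]
  [Differential H] [DifferentialAlgebra K H]

/-- A `∂`-`K`-Hopf subalgebra of `H`. -/
structure DiffHopfSubalgebra extends Subalgebra K H where
  comul_mem : ∀ z ∈ toSubalgebra, Coalgebra.comul (R := K) z ∈
    LinearMap.range (TensorProduct.map toSubalgebra.val.toLinearMap toSubalgebra.val.toLinearMap)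
  antipode_mem : ∀ z ∈ toSubalgebra, HopfAlgebra.antipode K z ∈ toSubalgebra
  deriv_mem : ∀ z ∈ toSubalgebra, (z′) ∈ toSubalgebra

variable {K H}

namespace DiffHopfSubalgebra

variable (Z : DiffHopfSubalgebra K H)

/-- The ideal `(Z⁺)` of `H` generated by the augmentation ideal `Z⁺ = Ker(ε : Z → K)`. -/
def augIdeal : Ideal H :=
  Ideal.span {z : H | z ∈ Z.toSubalgebra ∧ Coalgebra.counit (R := K) z = 0}

theorem mk_eq_of_mem {z : H} (hz : z ∈ Z.toSubalgebra) :
    Ideal.Quotient.mkₐ K Z.augIdeal z =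
      algebraMap K (H ⧸ Z.augIdeal) (Coalgebra.counit (R := K) z) := by
  rw [← AlgHom.commutes (Ideal.Quotient.mkₐ K Z.augIdeal), Ideal.Quotient.mkₐ_eq_mk,
    Ideal.Quotient.mk_eq_mk_iff_sub_mem]
  refine Ideal.subset_span ⟨sub_mem hz (Subalgebra.algebraMap_mem _ _), ?_⟩
  simp

theorem map_mk_of_mem_range (w : H ⊗[K] H)
    (hw : w ∈ LinearMap.range (TensorProduct.map Z.toSubalgebra.val.toLinearMap
      Z.toSubalgebra.val.toLinearMap)) :
    Algebra.TensorProduct.map (Ideal.Quotient.mkₐ K Z.augIdeal) (Ideal.Quotient.mkₐ K Z.augIdeal) w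
      = algebraMap K _ (TensorProduct.lid K K (TensorProduct.map (Coalgebra.counit (R := K))
          (Coalgebra.counit (R := K)) w)) := by
  obtain ⟨v, rfl⟩ := hw
  induction v using TensorProduct.induction_on with
  | zero => simp
  | add x y hx hy => simp only [map_add, hx, hy]
  | tmul a b =>
    simp only [TensorProduct.map_tmul, Algebra.TensorProduct.map_tmul, AlgHom.toLinearMap_apply,
      Subalgebra.coe_val, Z.mk_eq_of_mem a.2, Z.mk_eq_of_mem b.2, TensorProduct.lid_tmul,
      smul_eq_mul, Algebra.TensorProduct.algebraMap_apply, map_mul]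
    rw [Algebra.algebraMap_eq_smul_one (Coalgebra.counit (R := K) (b : H)),
      TensorProduct.tmul_smul, TensorProduct.smul_tmul', Algebra.smul_def, mul_comm,
      ← Algebra.algebraMap_eq_smul_one, Algebra.TensorProduct.tmul_mul_tmul, one_mul]

instance isHopfIdeal : Z.augIdeal.IsHopfIdeal K where
  counit_eq_zero x hx := by
    have : Z.augIdeal ≤ RingHom.ker (Bialgebra.counitAlgHom K H) :=
      Ideal.span_le.mpr fun z hz => hz.2
    exact this hx
  map_mkQ_comul_eq_zero x hx := by
    have : Z.augIdeal ≤ RingHom.ker ((Algebra.TensorProduct.map (Ideal.Quotient.mkₐ K Z.augIdeal)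
        (Ideal.Quotient.mkₐ K Z.augIdeal)).comp (Bialgebra.comulAlgHom K H)) := by
      refine Ideal.span_le.mpr fun z hz => ?_
      have h := Z.map_mk_of_mem_range _ (Z.comul_mem z hz.1)
      have hc : TensorProduct.lid K K (TensorProduct.map (Coalgebra.counit (R := K))
          (Coalgebra.counit (R := K)) (Coalgebra.comul (R := K) z)) = 0 := by
        have e : TensorProduct.map (Coalgebra.counit (R := K) (A := H))
            (Coalgebra.counit (R := K) (A := H)) =
            (Coalgebra.counit (R := K)).lTensor K ∘ₗ (Coalgebra.counit (R := K)).rTensor H := by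
          rw [LinearMap.lTensor_comp_rTensor]
        rw [e, LinearMap.comp_apply, Coalgebra.rTensor_counit_comul]
        simp [hz.2]
      rw [hc, map_zero] at h
      exact h
    exact this hx
  antipode_mem x hx := by
    have : Z.augIdeal ≤ Z.augIdeal.comap (HopfAlgebra.antipodeAlgHom K H) :=
      Ideal.span_le.mpr fun z hz => Ideal.subset_span
        ⟨Z.antipode_mem z hz.1, (HopfAlgebra.counit_antipode z).trans hz.2⟩
    exact this hx

/-- The quotient Hopf algebra `H/(Z⁺)`. -/
abbrev Quot : Type _ := H ⧸ Z.augIdeal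

variable [DiffHopfAlgebra K H]

theorem deriv_mem_augIdeal {x : H} (hx : x ∈ Z.augIdeal) : (x′) ∈ Z.augIdeal := by
  refine Submodule.span_induction ?_ ?_ ?_ ?_ hx
  · intro z hz
    refine Ideal.subset_span ⟨Z.deriv_mem z hz.1, ?_⟩
    rw [DiffHopfAlgebra.counit_deriv, hz.2, map_zero]
  · simp
  · intro x y _ _ hx hy
    rw [map_add]
    exact add_mem hx hy
  · intro a x hx hx'
    rw [smul_eq_mul, Derivation.leibniz]
    exact add_mem (Ideal.mul_mem_left _ _ hx') (Ideal.mul_mem_right _ _ hx)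

/-- The operator on `H/(Z⁺)` induced by the one on `H`. -/
instance instDifferentialQuot : Differential Z.Quot where
  deriv := Derivation.mk'
    (QuotientAddGroup.map Z.augIdeal.toAddSubgroup Z.augIdeal.toAddSubgroup
      (Differential.deriv (R := H)).toLinearMap.toAddMonoidHom
      (fun _ hx => Z.deriv_mem_augIdeal hx)).toIntLinearMap
    (by
      intro x y
      obtain ⟨x, rfl⟩ := Ideal.Quotient.mk_surjective x
      obtain ⟨y, rfl⟩ := Ideal.Quotient.mk_surjective y
      change Ideal.Quotient.mk Z.augIdeal ((x * y)′) = Ideal.Quotient.mk Z.augIdeal x *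
        Ideal.Quotient.mk Z.augIdeal (y′) + Ideal.Quotient.mk Z.augIdeal y *
        Ideal.Quotient.mk Z.augIdeal (x′)
      rw [Derivation.leibniz, map_add, smul_eq_mul, smul_eq_mul, map_mul, map_mul])

@[simp] theorem deriv_mk (x : H) :
    (Ideal.Quotient.mk Z.augIdeal x : Z.Quot)′ = Ideal.Quotient.mk Z.augIdeal (x′) := rfl

instance instDifferentialAlgebraQuot : DifferentialAlgebra K Z.Quot where
  deriv_algebraMap c := by
    change Ideal.Quotient.mk Z.augIdeal ((algebraMap K H c)′) =
      Ideal.Quotient.mk Z.augIdeal (algebraMap K H (c′))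
    rw [deriv_algebraMap]

instance instDiffHopfAlgebraQuot : DiffHopfAlgebra K Z.Quot where
  comul_deriv x := by
    obtain ⟨x, rfl⟩ := Ideal.Quotient.mk_surjective x
    rw [deriv_mk, Bialgebra.Quotient.comul_mk, Bialgebra.Quotient.comul_mk,
      DiffHopfAlgebra.comul_deriv]
    generalize Coalgebra.comul (R := K) x = w
    induction w using TensorProduct.induction_on with
    | zero => simp
    | add x y hx hy => simp only [map_add, hx, hy]
    | tmul a b => rfl
  counit_deriv x := by
    obtain ⟨x, rfl⟩ := Ideal.Quotient.mk_surjective x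
    exact DiffHopfAlgebra.counit_deriv x
  antipode_deriv x := by
    obtain ⟨x, rfl⟩ := Ideal.Quotient.mk_surjective x
    exact congrArg (Ideal.Quotient.mk Z.augIdeal) (DiffHopfAlgebra.antipode_deriv x)

end DiffHopfSubalgebra

end HopfSub

/-! ### The Lie algebra of an affine `∂`-`K`-group -/

section LieAlg

variable (K H : Type*) [CommRing K] [CommRing H] [HopfAlgebra K H]

instance instLieRingConv : LieRing (WithConv (H →ₗ[K] K)) := LieRing.ofAssociativeRing

instance instLieAlgebraConv : LieAlgebra K (WithConv (H →ₗ[K] K)) :=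
  LieAlgebra.ofAssociativeAlgebra

variable {K H} in
theorem conv_mul_apply_mul {D E : WithConv (H →ₗ[K] K)}
    (hD : ∀ a b : H, D (a * b) =
      D a * Coalgebra.counit (R := K) b + Coalgebra.counit (R := K) a * D b)
    (hE : ∀ a b : H, E (a * b) =
      E a * Coalgebra.counit (R := K) b + Coalgebra.counit (R := K) a * E b) (a b : H) :
    (D * E) (a * b) = (D * E) a * Coalgebra.counit (R := K) b + D a * E b + E a * D b +
      Coalgebra.counit (R := K) a * (D * E) b := by
  have key : ∀ v w : H ⊗[K] H,
      LinearMap.mul' K K (TensorProduct.map D.ofConv E.ofConv (v * w)) =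
      LinearMap.mul' K K (TensorProduct.map D.ofConv E.ofConv v) *
        LinearMap.mul' K K (TensorProduct.map Coalgebra.counit Coalgebra.counit w) +
      LinearMap.mul' K K (TensorProduct.map D.ofConv Coalgebra.counit v) *
        LinearMap.mul' K K (TensorProduct.map Coalgebra.counit E.ofConv w) +
      LinearMap.mul' K K (TensorProduct.map Coalgebra.counit E.ofConv v) *
        LinearMap.mul' K K (TensorProduct.map D.ofConv Coalgebra.counit w) +
      LinearMap.mul' K K (TensorProduct.map Coalgebra.counit Coalgebra.counit v) *
        LinearMap.mul' K K (TensorProduct.map D.ofConv E.ofConv w) := by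
    intro v w
    induction v using TensorProduct.induction_on with
    | zero => simp
    | add x y hx hy => simp only [add_mul, map_add, hx, hy]; ring
    | tmul a b =>
      induction w using TensorProduct.induction_on with
      | zero => simp
      | add x y hx hy => simp only [mul_add, map_add, hx, hy]; ring
      | tmul c d =>
        simp only [Algebra.TensorProduct.tmul_mul_tmul, TensorProduct.map_tmul,
          LinearMap.mul'_apply]
        rw [hD, hE]; ring
  have hone : ∀ (F : WithConv (H →ₗ[K] K)) (x : H),
      LinearMap.mul' K K (TensorProduct.map Coalgebra.counit F.ofConv (Coalgebra.comul x)) = F x :=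
    fun F x => LinearMap.congr_fun (congrArg WithConv.ofConv (one_mul F)) x
  have hone' : ∀ (F : WithConv (H →ₗ[K] K)) (x : H),
      LinearMap.mul' K K (TensorProduct.map F.ofConv Coalgebra.counit (Coalgebra.comul x)) = F x :=
    fun F x => LinearMap.congr_fun (congrArg WithConv.ofConv (mul_one F)) x
  have hone'' : ∀ (x : H), LinearMap.mul' K K (TensorProduct.map Coalgebra.counit Coalgebra.counit
      (Coalgebra.comul x)) = Coalgebra.counit (R := K) x := fun x => hone 1 x
  simp only [LinearMap.convMul_apply, Bialgebra.comul_mul]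
  rw [key, hone'', hone'', hone' D, hone E, hone E, hone' D]

/-- `Lie(Spec H) = Der_ε(H, K)`, with the bracket `[D, E] = D * E - E * D` for the convolution
product `D * E = (D ⊗ E) ∘ Δ`. -/
def hopfLie : LieSubalgebra K (WithConv (H →ₗ[K] K)) where
  carrier := {D | ∀ a b : H, D (a * b) =
    D a * Coalgebra.counit (R := K) b + Coalgebra.counit (R := K) a * D b}
  zero_mem' a b := by simp
  add_mem' {D E} hD hE a b := by
    have hD := hD a b
    have hE := hE a b
    simp only [WithConv.ofConv_add, LinearMap.add_apply] at *
    rw [hD, hE]; ring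
  smul_mem' c D hD a b := by
    have hD := hD a b
    simp only [WithConv.ofConv_smul, LinearMap.smul_apply, smul_eq_mul] at *
    rw [hD]; ring
  lie_mem' {D E} hD hE a b := by
    have h1 := conv_mul_apply_mul hD hE a b
    have h2 := conv_mul_apply_mul hE hD a b
    change (D * E) (a * b) - (E * D) (a * b) = ((D * E) a - (E * D) a) * _ +
      _ * ((D * E) b - (E * D) b)
    rw [h1, h2]; ring

variable {K H} [Differential K] [Differential H] [DifferentialAlgebra K H] [DiffHopfAlgebra K H]

/-- The operator `(∂D)(a) = ∂(D a) - D(∂a)` on `Lie(Spec H)`. -/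
def hopfLieDeriv (D : hopfLie K H) : hopfLie K H :=
  ⟨WithConv.toConv
    { toFun := fun a => (D.1 a)′ - D.1 (a′)
      map_add' := fun a b => by simp only [map_add]; ring
      map_smul' := fun c a => by
        simp only [deriv_smul, map_add, map_smul, smul_eq_mul, Derivation.leibniz,
          RingHom.id_apply]
        ring },
    fun a b => by
      have hD := D.2
      change (D.1 (a * b))′ - D.1 ((a * b)′) = ((D.1 a)′ - D.1 (a′)) * _ +
        _ * ((D.1 b)′ - D.1 (b′))
      simp only [Derivation.leibniz, smul_eq_mul, map_add]
      rw [hD a b, hD a (b′), hD b (a′), DiffHopfAlgebra.counit_deriv,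
        DiffHopfAlgebra.counit_deriv]
      simp only [map_add, Derivation.leibniz, smul_eq_mul]
      ring⟩

@[simp] theorem hopfLieDeriv_apply (D : hopfLie K H) (a : H) :
    (hopfLieDeriv D).1 a = (D.1 a)′ - D.1 (a′) := rfl

end LieAlg

/-- The identity element of the affine `K`-group `Spec H`, as a point of the underlying space. -/
def identityPoint (K H : Type*) [Field K] [CommRing H] [HopfAlgebra K H] : PrimeSpectrum H :=
  PrimeSpectrum.comap (Bialgebra.counitAlgHom K H).toRingHom ⊥

end DiffTorsor

end

open DiffTorsor

/-! The subalgebra `Z'` is the set of `z` in `H'` with `dz = 0` in the module of Kähler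
differentials over `K`, that is, the locally constant functions on the group. Describing `Z'` by a
linear equation, rather than as a union of separable subalgebras, makes its Hopf structure and its
stability under `∂` easy to obtain. All the work is in showing that such functions really are
locally constant.

`H'` is of finite type: the two Galois maps make `B ⊗ H'` a quotient of `B ⊗ H`, and finite type
descends from `B` to `K` (`finiteType_of_isBiGalois`). Also `K` has characteristic zero. Let `dz =
0` and let `z` vanish at a closed point `p`. Derivations of a Hopf algebra lift along surjections of
modules (`exists_derivation_lift`), so there is a derivation `E` that acts on `p^k/p^(k+1)` as
multiplication by `k`. From `E z = 0` it follows that `z` lies in every power of `p`, and Krull's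
intersection theorem makes `z` vanish near `p`. Applied to `f(z)`, with `f` the minimal polynomial
of the value of `z` at `p`, this shows that `z` is locally, hence globally, a root of a squarefree
polynomial (`exists_separable_of_D_eq_zero`).

The rest follows from this polynomial. It makes `Z'` étale, and `z` a multiple of `z²`. So a locally
constant function is determined by its values at one closed point on each irreducible component, and
`Z'` is finite-dimensional. Differentiating `f(z) = 0` gives stability under `∂`. The ideal `(Z'^+)`
equals its square, so it is generated by an idempotent and cuts out an open and closed subgroup.
This subgroup is connected, because its idempotents lift to elements of `Z'`, which are constants
modulo `(Z'^+)`. A point derivation at the identity kills the idempotent, so the Lie algebra does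
not change. -/

noncomputable section

namespace DiffTorsor

/-! ### Derivations of a commutative Hopf algebra and their values at the identity -/

section HopfDerivation

variable {K A N : Type*} [CommRing K] [CommRing A] [HopfAlgebra K A]
  [AddCommGroup N] [Module K N] [Module A N] [IsScalarTower K A N]

/-- The linear map `a ⊗ b ↦ u(a) • f(b)`. -/
def actTensor {P Q : Type*} [AddCommGroup P] [Module K P] [AddCommGroup Q] [Module K Q]
    (u : P →ₗ[K] A) (f : Q →ₗ[K] N) : P ⊗[K] Q →ₗ[K] N :=
  TensorProduct.lift (((Algebra.lsmul K K N).toLinearMap ∘ₗ u).compl₂ f)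

@[simp] theorem actTensor_tmul {P Q : Type*} [AddCommGroup P] [Module K P] [AddCommGroup Q]
    [Module K Q] (u : P →ₗ[K] A) (f : Q →ₗ[K] N) (a : P) (b : Q) :
    actTensor u f (a ⊗ₜ[K] b) = u a • f b := rfl

/-- For `v = Δx` and `w = Δy` the coefficients `S(x₁)x₂` and `S(y₁)y₂` collapse to counits, which
yields the Leibniz rule at the identity. Arbitrary tensors are allowed so that induction on `v` and
`w` applies. -/
theorem actTensor_antipode_mul (r : Derivation K A N) (v w : A ⊗[K] A) :
    actTensor (HopfAlgebra.antipode K) r.toLinearMap (v * w) =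
      LinearMap.mul' K A ((HopfAlgebra.antipode K).rTensor A v) •
        actTensor (HopfAlgebra.antipode K) r.toLinearMap w +
      LinearMap.mul' K A ((HopfAlgebra.antipode K).rTensor A w) •
        actTensor (HopfAlgebra.antipode K) r.toLinearMap v := by
  induction v using TensorProduct.induction_on with
  | zero => simp
  | add x y hx hy => simp only [add_mul, map_add, hx, hy, add_smul, smul_add]; abel
  | tmul a b =>
    induction w using TensorProduct.induction_on with
    | zero => simp
    | add x y hx hy => simp only [mul_add, map_add, hx, hy, add_smul, smul_add]; abel
    | tmul c d =>
      simp only [Algebra.TensorProduct.tmul_mul_tmul, actTensor_tmul, Derivation.coeFn_coe,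
        Derivation.leibniz, LinearMap.rTensor_tmul, LinearMap.mul'_apply,
        smul_add, smul_smul, HopfAlgebra.antipode_mul_distrib]
      congr 2 <;> ring

/-- The derivation at the identity `x ↦ S(x₁) • r(x₂)` associated to a derivation `r`. -/
def derivationAtOne (r : Derivation K A N) : A →ₗ[K] N :=
  actTensor (HopfAlgebra.antipode K) r.toLinearMap ∘ₗ Coalgebra.comul (R := K)

theorem derivationAtOne_mul (r : Derivation K A N) (x y : A) :
    derivationAtOne r (x * y) = Coalgebra.counit (R := K) x • derivationAtOne r y +
      Coalgebra.counit (R := K) y • derivationAtOne r x := by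
  simp only [derivationAtOne, LinearMap.comp_apply, Bialgebra.comul_mul, actTensor_antipode_mul,
    HopfAlgebra.mul_antipode_rTensor_comul_apply, algebraMap_smul]

theorem actTensor_mul {f : A →ₗ[K] N} (hf : ∀ x y, f (x * y) =
    Coalgebra.counit (R := K) x • f y + Coalgebra.counit (R := K) y • f x) (v w : A ⊗[K] A) :
    actTensor LinearMap.id f (v * w) =
      TensorProduct.rid K A ((Coalgebra.counit (R := K)).lTensor A v) •
        actTensor LinearMap.id f w +
      TensorProduct.rid K A ((Coalgebra.counit (R := K)).lTensor A w) •
        actTensor LinearMap.id f v := by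
  induction v using TensorProduct.induction_on with
  | zero => simp
  | add x y hx hy => simp only [add_mul, map_add, hx, hy, add_smul, smul_add]; abel
  | tmul a b =>
    induction w using TensorProduct.induction_on with
    | zero => simp
    | add x y hx hy => simp only [mul_add, map_add, hx, hy, add_smul, smul_add]; abel
    | tmul c d =>
      simp only [Algebra.TensorProduct.tmul_mul_tmul, actTensor_tmul, LinearMap.id_apply, hf,
        LinearMap.lTensor_tmul, TensorProduct.rid_tmul, smul_add]
      simp only [← algebraMap_smul A (Coalgebra.counit (R := K) b),
        ← algebraMap_smul A (Coalgebra.counit (R := K) d), smul_smul, smul_eq_mul]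
      congr 2 <;> ring

/-- The invariant derivation `x ↦ x₁ • f(x₂)` associated to a derivation `f` at the identity. -/
def invariantDerivation (f : A →ₗ[K] N) (hf : ∀ x y, f (x * y) =
    Coalgebra.counit (R := K) x • f y + Coalgebra.counit (R := K) y • f x) : Derivation K A N :=
  Derivation.mk' (actTensor LinearMap.id f ∘ₗ Coalgebra.comul (R := K)) fun x y => by
    simp only [LinearMap.comp_apply, Bialgebra.comul_mul, actTensor_mul hf,
      Coalgebra.lTensor_counit_comul, TensorProduct.rid_tmul, one_smul]

/-- A derivation is recovered from its value at the identity: by coassociativity, `x₁ S(x₂) r(x₃) =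
ε(x₁) r(x₂) = r(x)`. -/
theorem actTensor_derivationAtOne_comul (r : Derivation K A N) (x : A) :
    actTensor LinearMap.id (derivationAtOne r) (Coalgebra.comul (R := K) x) = r x := by
  have h1 : actTensor LinearMap.id (derivationAtOne r) =
      actTensor LinearMap.id (actTensor (HopfAlgebra.antipode K) r.toLinearMap) ∘ₗ
        (Coalgebra.comul (R := K)).lTensor A := by
    ext a b; rfl
  have h2 : actTensor LinearMap.id (actTensor (HopfAlgebra.antipode K) r.toLinearMap) ∘ₗ
      (TensorProduct.assoc K A A A).toLinearMap =
      actTensor (LinearMap.mul' K A ∘ₗ (HopfAlgebra.antipode K).lTensor A) r.toLinearMap := by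
    ext a b c
    simp [mul_smul]
  have h3 : actTensor (LinearMap.mul' K A ∘ₗ (HopfAlgebra.antipode K).lTensor A) r.toLinearMap ∘ₗ
      (Coalgebra.comul (R := K)).rTensor A =
      r.toLinearMap ∘ₗ (TensorProduct.lid K A).toLinearMap ∘ₗ
        (Coalgebra.counit (R := K)).rTensor A := by
    ext a b
    simp [HopfAlgebra.mul_antipode_lTensor_comul_apply]
  have h4 := LinearMap.congr_fun h2 ((Coalgebra.comul (R := K)).rTensor A (Coalgebra.comul x))
  have h5 := LinearMap.congr_fun h3 (Coalgebra.comul x)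
  simp only [LinearMap.comp_apply, LinearEquiv.coe_coe, Coalgebra.coassoc_apply,
    Coalgebra.rTensor_counit_comul, TensorProduct.lid_tmul, one_smul] at h4 h5
  rw [h1, LinearMap.comp_apply, h4]
  exact h5

end HopfDerivation

/-- The module of differentials of a commutative Hopf algebra over a field has the lifting property
of projective modules. -/
theorem exists_derivation_lift {K A N N₁ : Type*} [Field K] [CommRing A] [HopfAlgebra K A]
    [AddCommGroup N] [Module K N] [Module A N] [IsScalarTower K A N]
    [AddCommGroup N₁] [Module K N₁] [Module A N₁] [IsScalarTower K A N₁]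
    (π : N →ₗ[A] N₁) (hπ : Function.Surjective π) (r : Derivation K A N₁) :
    ∃ E : Derivation K A N, ∀ x, π (E x) = r x := by
  -- A section that is only `K`-linear suffices: the Leibniz rule at the identity involves only
  -- scalars `ε(x)` in `K`, so it survives composition with `s`.
  obtain ⟨s, hs⟩ := (π.restrictScalars K).exists_rightInverse_of_surjective
    (LinearMap.range_eq_top.mpr hπ)
  refine ⟨invariantDerivation (s ∘ₗ derivationAtOne r) fun x y => ?_, fun x => ?_⟩
  · simp only [LinearMap.comp_apply, derivationAtOne_mul, map_add, map_smul]
  · have h : π.restrictScalars K ∘ₗ actTensor LinearMap.id (s ∘ₗ derivationAtOne r) =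
        actTensor (A := A) LinearMap.id (derivationAtOne r) := by
      ext a b
      have := LinearMap.congr_fun hs (derivationAtOne r b)
      simp only [LinearMap.comp_apply, LinearMap.coe_restrictScalars, LinearMap.id_apply] at this
      simp [this]
    exact (LinearMap.congr_fun h _).trans (actTensor_derivationAtOne_comul r x)

/-! ### Functions with zero differential in characteristic zero -/

section Euler

variable {K A : Type*} [Field K] [CommRing A]

theorem derivation_eq_zero_of_D_eq_zero [Algebra K A] {N : Type*} [AddCommGroup N] [Module K N]
    [Module A N] [IsScalarTower K A N] {z : A} (hz : KaehlerDifferential.D K A z = 0)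
    (E : Derivation K A N) : E z = 0 := by
  rw [← E.liftKaehlerDifferential_comp_D, hz, map_zero]

/-- At a closed point of an affine group of finite type in characteristic zero, there is a vector
field that agrees to first order with the Euler vector field. -/
theorem exists_euler_derivation [CharZero K] [HopfAlgebra K A] [Algebra.FiniteType K A]
    (p : Ideal A) [p.IsMaximal] : ∃ E : Derivation K A A, ∀ x ∈ p, E x - x ∈ p ^ 2 := by
  let _ : Field (A ⧸ p) := Ideal.Quotient.field p
  have : Module.Finite K (A ⧸ p) := finite_of_finite_type_of_isJacobsonRing K (A ⧸ p)
  let g : A ⧸ p ^ 2 →ₐ[K] A ⧸ p := Ideal.Quotient.factorₐ K (Ideal.pow_le_self two_ne_zero)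
  have hg : Function.Surjective g :=
    Ideal.Quotient.factor_surjective (Ideal.pow_le_self two_ne_zero)
  have hker : ∀ x y : A ⧸ p ^ 2, g x = 0 → g y = 0 → x * y = 0 := by
    intro x y hx hy
    obtain ⟨x, rfl⟩ := Ideal.Quotient.mk_surjective x
    obtain ⟨y, rfl⟩ := Ideal.Quotient.mk_surjective y
    replace hx : x ∈ p := Ideal.Quotient.eq_zero_iff_mem.mp hx
    replace hy : y ∈ p := Ideal.Quotient.eq_zero_iff_mem.mp hy
    rw [← map_mul, Ideal.Quotient.eq_zero_iff_mem, pow_two]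
    exact Ideal.mul_mem_mul hx hy
  have hnil : IsNilpotent (RingHom.ker (g : A ⧸ p ^ 2 →+* A ⧸ p)) := by
    refine ⟨2, ?_⟩
    refine (pow_two (RingHom.ker (g : A ⧸ p ^ 2 →+* A ⧸ p))).trans ?_
    rw [Ideal.zero_eq_bot, eq_bot_iff, Ideal.mul_le]
    exact fun x hx y hy => hker x y hx hy
  -- The residue field is finite over a field of characteristic zero, hence formally smooth, so it
  -- lifts through the square-zero extension.
  let s : A ⧸ p →ₐ[K] A ⧸ p ^ 2 :=
    Algebra.FormallySmooth.liftOfSurjective (AlgHom.id K (A ⧸ p)) g hg hnil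
  have hs : ∀ x, g (s x) = x := fun x =>
    Algebra.FormallySmooth.liftOfSurjective_apply (AlgHom.id K (A ⧸ p)) g hg hnil x
  let q : A →ₐ[K] A ⧸ p ^ 2 := Ideal.Quotient.mkₐ K (p ^ 2)
  let t : A →ₐ[K] A ⧸ p ^ 2 := s.comp (Ideal.Quotient.mkₐ K p)
  have hgt : ∀ x, g (q x - t x) = 0 := by
    intro x
    rw [map_sub, AlgHom.comp_apply, hs]
    exact sub_self _
  -- The difference of two algebra maps that agree modulo a square-zero ideal is a derivation. Since
  -- `t` kills `p`, this one sends each `x` in `p` to its own class.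
  let r : Derivation K A (A ⧸ p ^ 2) := Derivation.mk' (q.toLinearMap - t.toLinearMap) (by
    intro x y
    have h := hker _ _ (hgt x) (hgt y)
    have hq : ∀ (a : A) (b : A ⧸ p ^ 2), a • b = q a * b := fun a b => Algebra.smul_def a b
    simp only [LinearMap.sub_apply, AlgHom.toLinearMap_apply, map_mul, hq]
    linear_combination -h)
  obtain ⟨E, hE⟩ := exists_derivation_lift (Submodule.mkQ (p ^ 2))
    (Submodule.mkQ_surjective _) r
  refine ⟨E, fun x hx => ?_⟩
  rw [← Ideal.Quotient.eq]
  refine (hE x).trans ?_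
  have h0 : Ideal.Quotient.mkₐ K p x = 0 := Ideal.Quotient.eq_zero_iff_mem.mpr hx
  change q x - s (Ideal.Quotient.mkₐ K p x) = q x
  rw [h0, map_zero, sub_zero]

/-- By the Leibniz rule, `E(ab) - (k+2)ab = a(Eb - b) + (Ea - (k+1)a)b` for `a` in `p^(k+1)` and `b`
in `p`. The exponent is shifted by one so that the induction starts from the hypothesis on `p`
itself. -/
theorem euler_pow [Algebra K A] {p : Ideal A} {E : Derivation K A A}
    (hE : ∀ x ∈ p, E x - x ∈ p ^ 2) (k : ℕ) :
    ∀ y ∈ p ^ (k + 1), E y - (k + 1 : ℕ) * y ∈ p ^ (k + 1 + 1) := by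
  induction k with
  | zero => simpa using hE
  | succ k ih =>
    intro y hy
    rw [pow_succ] at hy
    refine Submodule.mul_induction_on hy (fun a ha b hb => ?_) (fun x y hx hy => ?_)
    · have h1 : a * (E b - b) ∈ p ^ (k + 1 + 1 + 1) := by
        rw [add_assoc, pow_add p (k + 1)]
        exact Ideal.mul_mem_mul ha (hE b hb)
      have h2 : (E a - (k + 1 : ℕ) * a) * b ∈ p ^ (k + 1 + 1 + 1) := by
        rw [pow_succ]
        exact Ideal.mul_mem_mul (ih a ha) hb
      rw [Derivation.leibniz]
      convert add_mem h1 h2 using 1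
      push_cast
      simp only [smul_eq_mul]
      ring
    · rw [map_add]
      convert add_mem hx hy using 1
      ring

/-- A function with zero differential that vanishes at a closed point of an affine group in
characteristic zero vanishes in a neighbourhood of this point. -/
theorem exists_mul_eq_self_of_D_eq_zero [CharZero K] [HopfAlgebra K A] [Algebra.FiniteType K A]
    (p : Ideal A) [p.IsMaximal] {z : A} (hz : KaehlerDifferential.D K A z = 0) (hzp : z ∈ p) :
    ∃ r ∈ p, r * z = z := by
  have : IsNoetherianRing A := Algebra.FiniteType.isNoetherianRing K A
  obtain ⟨E, hE⟩ := exists_euler_derivation (K := K) p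
  have hEz := derivation_eq_zero_of_D_eq_zero hz E
  have key : ∀ k : ℕ, z ∈ p ^ (k + 1) := by
    intro k
    induction k with
    | zero => simpa using hzp
    | succ k ih =>
      have h := euler_pow hE k z ih
      rw [hEz, zero_sub, neg_mem_iff] at h
      -- `E z = 0` leaves `(k+1) z` in `p^(k+2)`; characteristic zero permits division by `k+1`.
      have h' := Ideal.mul_mem_left _ (algebraMap K A ((k + 1 : ℕ) : K)⁻¹) h
      rwa [← mul_assoc, ← map_natCast (algebraMap K A), ← map_mul,
        inv_mul_cancel₀ (Nat.cast_ne_zero.mpr k.succ_ne_zero), map_one, one_mul] at h'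
  have hmem : z ∈ (⨅ i : ℕ, p ^ i • ⊤ : Submodule A A) := by
    refine Submodule.mem_iInf _ |>.mpr fun i => ?_
    rw [smul_eq_mul, Ideal.mul_top]
    exact Ideal.pow_le_pow_right i.le_succ (key i)
  obtain ⟨r, hr⟩ := (Ideal.mem_iInf_smul_pow_eq_bot_iff p z).mp hmem
  exact ⟨r, r.2, hr⟩

open Polynomial UniqueFactorizationMonoid in
/-- A function with zero differential on an affine group of finite type in characteristic zero is
a root of a separable polynomial. -/
theorem exists_separable_of_D_eq_zero [CharZero K] [HopfAlgebra K A] [Algebra.FiniteType K A]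
    {z : A} (hz : KaehlerDifferential.D K A z = 0) :
    ∃ f : K[X], f.Separable ∧ aeval z f = 0 := by
  classical
  -- Passage from local to global: the set already is an ideal, because `f` and `g` both divide the
  -- radical of `fg`, which is again squarefree. So if `1` is in the span, it is in the set, and `z`
  -- is a root of a single squarefree polynomial.
  suffices h : Ideal.span {a : A | ∃ f : K[X], Squarefree f ∧ a * aeval z f = 0} = ⊤ by
    have h1 : (1 : A) ∈ Ideal.span {a : A | ∃ f : K[X], Squarefree f ∧ a * aeval z f = 0} := by
      rw [h]; trivial
    obtain ⟨f, hf, hf'⟩ : ∃ f : K[X], Squarefree f ∧ 1 * aeval z f = 0 := by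
      refine Submodule.span_induction (fun x hx => hx) ⟨1, squarefree_one, by simp⟩ ?_ ?_ h1
      · rintro x y _ _ ⟨f, hf, hfx⟩ ⟨g, hg, hgy⟩
        have h0 : f * g ≠ 0 := mul_ne_zero hf.ne_zero hg.ne_zero
        refine ⟨radical (f * g), squarefree_radical, ?_⟩
        obtain ⟨u, hu⟩ := (dvd_radical_iff hf.isRadical h0).mpr (dvd_mul_right f g)
        obtain ⟨v, hv⟩ := (dvd_radical_iff hg.isRadical h0).mpr (dvd_mul_left g f)
        rw [add_mul]
        nth_rewrite 1 [hu]
        rw [hv, map_mul, map_mul, ← mul_assoc, hfx, ← mul_assoc, hgy, zero_mul, zero_mul, add_zero]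
      · rintro a x _ ⟨f, hf, hfx⟩
        exact ⟨f, hf, by rw [smul_eq_mul, mul_assoc, hfx, mul_zero]⟩
    exact ⟨f, PerfectField.separable_iff_squarefree.mpr hf, by rwa [one_mul] at hf'⟩
  by_contra hne
  obtain ⟨p, hp, hle⟩ := Ideal.exists_le_maximal _ hne
  let _ : Field (A ⧸ p) := Ideal.Quotient.field p
  have : Module.Finite K (A ⧸ p) := finite_of_finite_type_of_isJacobsonRing K (A ⧸ p)
  have hint : IsIntegral K (Ideal.Quotient.mkₐ K p z) := Algebra.IsIntegral.isIntegral _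
  let f := minpoly K (Ideal.Quotient.mkₐ K p z)
  have hfp : aeval z f ∈ p := by
    rw [← Ideal.Quotient.eq_zero_iff_mem, ← Ideal.Quotient.mkₐ_eq_mk K, ← aeval_algHom_apply]
    exact minpoly.aeval _ _
  have hD : KaehlerDifferential.D K A (aeval z f) = 0 := by
    rw [Derivation.map_aeval, hz, smul_zero]
  obtain ⟨r, hr, hrz⟩ := exists_mul_eq_self_of_D_eq_zero p hD hfp
  -- `1 - r` annihilates `f(z)` with `f` irreducible, so it lies in the ideal and hence in `p`, as
  -- does `r`: a contradiction.
  have hmem : 1 - r ∈ p := hle (Ideal.subset_span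
    ⟨f, (minpoly.irreducible hint).squarefree, by rw [sub_mul, one_mul, hrz, sub_self]⟩)
  exact hp.ne_top ((Ideal.eq_top_iff_one _).mpr (by simpa using add_mem hmem hr))

end Euler

/-! ### Roots of separable polynomials -/

-- `0 = D(f(z)) = f'(z) D(z)`, and the Bézout identity for `f` and `f'` makes `f'(z)` invertible.
open Polynomial in
theorem derivation_eq_zero_of_separable {K A N : Type*} [CommRing K] [CommRing A] [Algebra K A]
    [AddCommGroup N] [Module K N] [Module A N] (D : Derivation K A N) {f : K[X]}
    (hf : f.Separable) {z : A} (hz : aeval z f = 0) : D z = 0 := by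
  obtain ⟨a, b, hab⟩ := hf
  have h1 := D.map_aeval f z
  rw [hz, map_zero] at h1
  have h2 : aeval z b * aeval z (derivative f) = 1 := by
    have := congrArg (aeval z) hab
    simpa [hz] using this
  rw [← one_smul A (D z), ← h2, mul_smul, ← h1, smul_zero]

open Polynomial in
/-- A root of a separable polynomial is von Neumann regular. -/
theorem exists_eq_mul_of_separable {K A : Type*} [Field K] [CommRing A] [Algebra K A]
    {f : K[X]} (hf : f.Separable) {z : A} (hz : aeval z f = 0) :
    ∃ g : K[X], z = z * z * aeval z g := by
  classical
  -- A squarefree divisor of `X²` divides `X`; evaluating the resulting Bézout expression for `X` at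
  -- `z` removes the term in `f`.
  have h : EuclideanDomain.gcd (X ^ 2) f ∣ X := by
    refine (hf.squarefree.squarefree_of_dvd (EuclideanDomain.gcd_dvd_right _ _)).isRadical 2 X ?_
    exact EuclideanDomain.gcd_dvd_left _ _
  obtain ⟨c, hc⟩ := h
  refine ⟨EuclideanDomain.gcdA (X ^ 2) f * c, ?_⟩
  have := congrArg (aeval z) hc
  rw [EuclideanDomain.gcd_eq_gcd_ab] at this
  simp only [aeval_X, map_mul, map_add, map_pow, hz, zero_mul, add_zero] at this
  rw [map_mul]
  linear_combination this

/-! ### The subalgebra of functions with zero differential -/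

section DiffConstants

variable (K A : Type*) [CommRing K] [CommRing A] [Algebra K A]

/-- The subalgebra of the elements of `A` with zero Kähler differential. -/
def kaehlerConstants : Subalgebra K A where
  carrier := {z | KaehlerDifferential.D K A z = 0}
  mul_mem' {a b} ha hb := by
    change KaehlerDifferential.D K A (a * b) = 0
    rw [Derivation.leibniz, show KaehlerDifferential.D K A a = 0 from ha,
      show KaehlerDifferential.D K A b = 0 from hb, smul_zero, smul_zero, add_zero]
  add_mem' {a b} ha hb := by
    change KaehlerDifferential.D K A (a + b) = 0
    rw [map_add, show KaehlerDifferential.D K A a = 0 from ha,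
      show KaehlerDifferential.D K A b = 0 from hb, add_zero]
  algebraMap_mem' c := Derivation.map_algebraMap _ c

variable {K A}

theorem mem_kaehlerConstants {z : A} :
    z ∈ kaehlerConstants K A ↔ KaehlerDifferential.D K A z = 0 := Iff.rfl

open Polynomial in
theorem mem_kaehlerConstants_of_separable {f : K[X]} (hf : f.Separable) {z : A}
    (hz : aeval z f = 0) : z ∈ kaehlerConstants K A :=
  derivation_eq_zero_of_separable _ hf hz

theorem mem_kaehlerConstants_of_isIdempotentElem {e : A} (he : IsIdempotentElem e) :
    e ∈ kaehlerConstants K A := by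
  refine mem_kaehlerConstants_of_separable (f := .X * (.X - 1)) ?_ ?_
  -- Bézout identity `-4(X² - X) + (2X - 1)² = 1`, valid over any ring.
  · refine ⟨-4, 2 * .X - 1, ?_⟩
    simp
    ring
  · simp [mul_sub, he.eq]

theorem algHom_mem_kaehlerConstants {C : Type*} [CommRing C] [Algebra K C] (φ : A →ₐ[K] C) {z : A}
    (hz : z ∈ kaehlerConstants K A) : φ z ∈ kaehlerConstants K C := by
  let _ : Algebra A C := φ.toRingHom.toAlgebra
  have : IsScalarTower K A C := .of_algebraMap_eq fun x => (φ.commutes x).symm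
  have h := congrArg (KaehlerDifferential.map K K A C) (mem_kaehlerConstants.mp hz)
  rwa [KaehlerDifferential.map_D, map_zero] at h

/-- A formally unramified subalgebra has zero Kähler differentials. -/
theorem le_kaehlerConstants (S : Subalgebra K A) [Algebra.FormallyUnramified K S] :
    S ≤ kaehlerConstants K A := by
  intro s hs
  have h : KaehlerDifferential.D K S ⟨s, hs⟩ = 0 := Subsingleton.elim _ _
  have := congrArg (KaehlerDifferential.map K K S A) h
  rwa [KaehlerDifferential.map_D, map_zero] at this

end DiffConstants

/-! ### Zero differentials in tensor products -/

section Field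

variable {K A : Type*} [Field K] [CommRing A]

/-- Over a field, tensoring preserves the exact sequence `0 → Z → A → Ω`. Used in one factor and
then in the other, it shows that `Z ⊗ Z` contains the intersection of the kernels of `d ⊗ 1` and `1
⊗ d`. This is how the coproduct is seen to restrict to `Z`. -/
theorem mem_range_map_of_D [Algebra K A] (x : A ⊗[K] A)
    (h1 : (KaehlerDifferential.D K A).toLinearMap.rTensor A x = 0)
    (h2 : (KaehlerDifferential.D K A).toLinearMap.lTensor A x = 0) :
    x ∈ LinearMap.range (TensorProduct.map (kaehlerConstants K A).val.toLinearMap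
      (kaehlerConstants K A).val.toLinearMap) := by
  set i := (kaehlerConstants K A).val.toLinearMap with hi
  set d := (KaehlerDifferential.D K A).toLinearMap with hd
  have hex : Function.Exact i d := fun z =>
    ⟨fun hz => ⟨⟨z, hz⟩, rfl⟩, fun ⟨y, hy⟩ => hy ▸ y.2⟩
  obtain ⟨y, rfl⟩ := (Module.Flat.rTensor_exact A hex x).mp h1
  have hinj : Function.Injective (i.rTensor Ω[A⁄K]) :=
    Module.Flat.rTensor_preserves_injective_linearMap i Subtype.val_injective
  have h3 : d.lTensor (kaehlerConstants K A) y = 0 := by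
    apply hinj
    rw [map_zero, ← h2, ← LinearMap.comp_apply, ← LinearMap.comp_apply,
      LinearMap.rTensor_comp_lTensor, LinearMap.lTensor_comp_rTensor]
  obtain ⟨w, rfl⟩ := (Module.Flat.lTensor_exact (kaehlerConstants K A) hex y).mp h3
  refine ⟨w, ?_⟩
  rw [← LinearMap.comp_apply, LinearMap.rTensor_comp_lTensor]

-- Differentials commute with base change: `S ⊗ Ω[A⁄K]` is the module of differentials of `S ⊗ A`
-- relative to `S`, with `1 ⊗ d` as universal derivation. The latter is in particular a
-- `K`-derivation, so it kills whatever the universal `K`-derivation kills.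
attribute [local instance] Algebra.TensorProduct.rightAlgebra in
theorem lTensor_D_eq_zero {S : Type*} [CommRing S] [Algebra K S] [Algebra K A] {x : S ⊗[K] A}
    (hx : x ∈ kaehlerConstants K (S ⊗[K] A)) :
    (KaehlerDifferential.D K A).toLinearMap.lTensor S x = 0 := by
  apply (KaehlerDifferential.tensorKaehlerEquivBase K S A (S ⊗[K] A)).injective
  have h : ∀ x : S ⊗[K] A, KaehlerDifferential.tensorKaehlerEquivBase K S A (S ⊗[K] A)
      ((KaehlerDifferential.D K A).toLinearMap.lTensor S x) =
      KaehlerDifferential.D S (S ⊗[K] A) x := by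
    intro x
    induction x using TensorProduct.induction_on with
    | zero => simp
    | add x y hx hy => simp only [map_add, hx, hy]
    | tmul a b =>
      rw [LinearMap.lTensor_tmul, KaehlerDifferential.tensorKaehlerEquivBase_tmul,
        Derivation.coeFn_coe, KaehlerDifferential.map_D, ← Derivation.map_smul,
        Algebra.TensorProduct.right_algebraMap_apply, TensorProduct.smul_tmul', smul_eq_mul,
        mul_one]
  rw [map_zero, h]
  exact derivation_eq_zero_of_D_eq_zero hx
    ((KaehlerDifferential.D S (S ⊗[K] A)).restrictScalars K)

theorem rTensor_D_eq_zero {S : Type*} [CommRing S] [Algebra K S] [Algebra K A] {x : A ⊗[K] S}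
    (hx : x ∈ kaehlerConstants K (A ⊗[K] S)) :
    (KaehlerDifferential.D K A).toLinearMap.rTensor S x = 0 := by
  have h : Algebra.TensorProduct.comm K A S x ∈ kaehlerConstants K (S ⊗[K] A) :=
    algHom_mem_kaehlerConstants (Algebra.TensorProduct.comm K A S).toAlgHom hx
  apply (TensorProduct.comm K _ _).injective
  rw [map_zero, ← lTensor_D_eq_zero h]
  exact (LinearMap.congr_fun (LinearMap.lTensor_comp_comm _) x).symm

/-! ### Finiteness, étaleness and Hopf structure of the constants -/

section HopfField

variable [CharZero K] [HopfAlgebra K A] [Algebra.FiniteType K A]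

/-- Evaluation at one closed point on each irreducible component is injective. If `z = z²w` vanishes
at these points, then the idempotent `zw` lies in every minimal prime, since otherwise `1 - zw`
would vanish at one of them. So `zw` is nilpotent, hence zero, and `z = z(zw) = 0`. -/
instance finiteDimensional_kaehlerConstants : FiniteDimensional K (kaehlerConstants K A) := by
  classical
  have : IsNoetherianRing A := Algebra.FiniteType.isNoetherianRing K A
  have : Finite (minimalPrimes A) := (minimalPrimes.finite_of_isNoetherianRing A).to_subtype
  have hex : ∀ q : minimalPrimes A, ∃ p : Ideal A, p.IsMaximal ∧ q.1 ≤ p := fun q =>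
    Ideal.exists_le_maximal _ q.2.isPrime.ne_top
  choose p hp hle using hex
  have hfin : ∀ q, Module.Finite K (A ⧸ p q) := fun q => by
    let _ : Field (A ⧸ p q) := Ideal.Quotient.field (p q)
    exact finite_of_finite_type_of_isJacobsonRing K (A ⧸ p q)
  let F : kaehlerConstants K A →ₗ[K] (Π q, A ⧸ p q) :=
    LinearMap.pi fun q => (Ideal.Quotient.mkₐ K (p q)).toLinearMap ∘ₗ
      (kaehlerConstants K A).val.toLinearMap
  refine Module.Finite.of_injective F (LinearMap.ker_eq_bot.mp (LinearMap.ker_eq_bot'.mpr ?_))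
  rintro ⟨z, hz⟩ hFz
  obtain ⟨f, hf, hfz⟩ := exists_separable_of_D_eq_zero hz
  obtain ⟨g, hg⟩ := exists_eq_mul_of_separable hf hfz
  set w := Polynomial.aeval z g
  have he : IsIdempotentElem (z * w) := by
    change z * w * (z * w) = z * w
    nth_rewrite 3 [hg]
    ring
  have hzp : ∀ q, z ∈ p q := fun q => Ideal.Quotient.eq_zero_iff_mem.mp (congrFun hFz q)
  have hnil : z * w ∈ (⊥ : Ideal A).radical := by
    rw [← Ideal.sInf_minimalPrimes, Ideal.mem_sInf]
    intro q hq
    have hprime : q.IsPrime := hq.isPrime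
    rcases hprime.mem_or_mem (he.mul_one_sub_self ▸ q.zero_mem : z * w * (1 - z * w) ∈ q)
      with h | h
    · exact h
    · have h1 : 1 - z * w ∈ p ⟨q, hq⟩ := hle ⟨q, hq⟩ h
      have h2 : z * w ∈ p ⟨q, hq⟩ := Ideal.mul_mem_right _ _ (hzp _)
      exact absurd ((Ideal.eq_top_iff_one _).mpr (by simpa using add_mem h1 h2)) (hp _).ne_top
  have hn' : z * w = 0 := by
    obtain ⟨n, hn⟩ := hnil
    have h := congrArg (· * (z * w)) (Ideal.mem_bot.mp hn)
    simp only [← pow_succ, he.pow_succ_eq, zero_mul] at h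
    exact h
  refine Subtype.ext ?_
  change z = 0
  rw [hg, mul_assoc, hn', mul_zero]

theorem isFiniteSeparable_kaehlerConstants : IsFiniteSeparable K (kaehlerConstants K A) := by
  refine ⟨inferInstance, ?_⟩
  have hΩ : Subsingleton Ω[kaehlerConstants K A⁄K] := by
    rw [← Submodule.subsingleton_iff (kaehlerConstants K A), ← subsingleton_iff_bot_eq_top,
      ← KaehlerDifferential.span_range_derivation, eq_comm, Submodule.span_eq_bot]
    rintro _ ⟨z, rfl⟩
    -- That `dz` vanishes in the differentials of `A` does not by itself give vanishing in those of
    -- the subalgebra; the separable equation, which already holds in the subalgebra, does.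
    obtain ⟨f, hf, hfz⟩ := exists_separable_of_D_eq_zero z.2
    refine derivation_eq_zero_of_separable _ hf (Subtype.ext ?_)
    refine Eq.trans ?_ hfz
    exact (Polynomial.aeval_algHom_apply (kaehlerConstants K A).val z f).symm
  have : Algebra.FormallyUnramified K (kaehlerConstants K A) := ⟨hΩ⟩
  have := Algebra.FormallyEtale.of_formallyUnramified_of_field K (kaehlerConstants K A)
  have := Algebra.FinitePresentation.of_finiteType (R := K) (A := kaehlerConstants K A)
    |>.mp inferInstance
  exact ⟨inferInstance, inferInstance⟩

variable (K A) in
/-- The elements of zero Kähler differential form a differential Hopf subalgebra. -/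
def kaehlerHopfSubalgebra [Differential K] [Differential A] [DifferentialAlgebra K A] :
    DiffHopfSubalgebra K A where
  toSubalgebra := kaehlerConstants K A
  comul_mem z hz := by
    have h := algHom_mem_kaehlerConstants (Bialgebra.comulAlgHom K A) hz
    exact mem_range_map_of_D _ (rTensor_D_eq_zero h) (lTensor_D_eq_zero h)
  antipode_mem z hz := algHom_mem_kaehlerConstants (HopfAlgebra.antipodeAlgHom K A) hz
  deriv_mem z hz := by
    obtain ⟨f, hf, hfz⟩ := exists_separable_of_D_eq_zero hz
    obtain ⟨a, b, hab⟩ := hf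
    have h1 : Polynomial.aeval z b * Polynomial.aeval z (Polynomial.derivative f) = 1 := by
      have := congrArg (Polynomial.aeval z) hab
      simpa [hfz] using this
    have h2 := Differential.deriv_aeval_eq z f
    rw [hfz, map_zero] at h2
    -- Implicit differentiation of `f(z) = 0`: since `b(z)` is the inverse of `f'(z)`, the
    -- derivative of `z` is a polynomial in `z`.
    have h3 : (z′) = -(Polynomial.aeval z b * Polynomial.aeval z (Differential.mapCoeffs f)) := by
      linear_combination (-(z′)) * h1 - Polynomial.aeval z b * h2
    rw [h3]
    have hpoly : ∀ q : Polynomial K, Polynomial.aeval z q ∈ kaehlerConstants K A := fun q => by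
      rw [show z = (kaehlerConstants K A).val ⟨z, hz⟩ from rfl, Polynomial.aeval_algHom_apply]
      exact Subtype.property _
    exact neg_mem (mul_mem (hpoly _) (hpoly _))

end HopfField

end Field

/-! ### The identity component -/

theorem counit_eq_zero_of_mem_augIdeal {K A : Type*} [CommRing K] [Differential K] [CommRing A]
    [HopfAlgebra K A] [Differential A] [DifferentialAlgebra K A] {Z : DiffHopfSubalgebra K A} {x : A}
    (hx : x ∈ Z.augIdeal) : Coalgebra.counit (R := K) x = 0 := by
  have h : Z.augIdeal ≤ RingHom.ker (Bialgebra.counitAlgHom K A) :=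
    Ideal.span_le.mpr fun z hz => hz.2
  exact h hx

section Component

variable {K A : Type*} [Field K] [CharZero K] [CommRing A] [HopfAlgebra K A]
  [Algebra.FiniteType K A]

variable [Differential K] [Differential A] [DifferentialAlgebra K A]

theorem sub_counit_mem_augIdeal {z : A} (hz : z ∈ kaehlerConstants K A) :
    z - algebraMap K A (Coalgebra.counit (R := K) z) ∈ (kaehlerHopfSubalgebra K A).augIdeal := by
  refine Ideal.subset_span ⟨sub_mem hz (Subalgebra.algebraMap_mem _ _), ?_⟩
  simp

/-- Each generator satisfies `z = z² g(z)`, so it lies in the square of the ideal; a finitely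
generated ideal equal to its square is generated by an idempotent. -/
theorem exists_augIdeal_eq_span :
    ∃ e : A, IsIdempotentElem e ∧ (kaehlerHopfSubalgebra K A).augIdeal = Ideal.span {e} := by
  have : IsNoetherianRing A := Algebra.FiniteType.isNoetherianRing K A
  refine (Ideal.isIdempotentElem_iff_of_fg _ (IsNoetherian.noetherian _)).mp ?_
  refine le_antisymm Ideal.mul_le_left (Ideal.span_le.mpr ?_)
  rintro z ⟨hz, hz0⟩
  obtain ⟨f, hf, hfz⟩ := exists_separable_of_D_eq_zero hz
  obtain ⟨g, hg⟩ := exists_eq_mul_of_separable hf hfz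
  have hmem : z ∈ (kaehlerHopfSubalgebra K A).augIdeal := Ideal.subset_span ⟨hz, hz0⟩
  rw [hg]
  exact Ideal.mul_mem_right _ _ (Ideal.mul_mem_mul hmem hmem)

/-- An idempotent of the quotient lifts to an idempotent of `A`. The lift has zero differential, so
modulo the ideal it equals its counit, an idempotent of the field `K`. -/
theorem isIdempotentElem_quot {x : (kaehlerHopfSubalgebra K A).Quot} (hx : IsIdempotentElem x) :
    x = 0 ∨ x = 1 := by
  obtain ⟨e, he, hspan⟩ := exists_augIdeal_eq_span (K := K) (A := A)
  obtain ⟨a, rfl⟩ := Ideal.Quotient.mk_surjective x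
  have hmk : ∀ y, Ideal.Quotient.mk (kaehlerHopfSubalgebra K A).augIdeal ((1 - e) * y) =
      Ideal.Quotient.mk _ y := by
    intro y
    rw [Ideal.Quotient.eq, hspan, Ideal.mem_span_singleton]
    exact ⟨-y, by ring⟩
  have ha : a * a - a ∈ (kaehlerHopfSubalgebra K A).augIdeal := by
    rw [← Ideal.Quotient.eq, map_mul]
    exact hx
  rw [hspan, Ideal.mem_span_singleton] at ha
  obtain ⟨c, hc⟩ := ha
  -- An arbitrary lift `a` is idempotent only modulo `e`; multiplication by `1 - e` corrects this
  -- without changing its class.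
  have hf : IsIdempotentElem ((1 - e) * a) := by
    have he' : e * e = e := he
    change (1 - e) * a * ((1 - e) * a) = (1 - e) * a
    linear_combination (1 - e) ^ 2 * hc + (c * e + a - c) * he'
  have hε : IsIdempotentElem (Coalgebra.counit (R := K) ((1 - e) * a)) := by
    have h := congrArg (Coalgebra.counit (R := K)) hf.eq
    rwa [Bialgebra.counit_mul] at h
  have hx' := Ideal.Quotient.eq.mpr
    (sub_counit_mem_augIdeal (mem_kaehlerConstants_of_isIdempotentElem (K := K) hf))
  rw [hmk] at hx'
  rcases IsIdempotentElem.iff_eq_zero_or_one.mp hε with h | h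
  · left
    rw [hx', h, map_zero, map_zero]
  · right
    rw [hx', h, map_one, map_one]

/-- The quotient is again a Hopf algebra of finite type, so `y = z - ε(z)` equals `y` times the
idempotent `y g(y)`. That idempotent is `0` or `1`, and its counit is `0`, so it vanishes together
with `y`. -/
theorem kaehlerConstants_quot : kaehlerConstants K (kaehlerHopfSubalgebra K A).Quot = ⊥ := by
  rw [eq_bot_iff]
  intro z hz
  set y := z - algebraMap K _ (Coalgebra.counit (R := K) z) with hy
  have hy' : y ∈ kaehlerConstants K (kaehlerHopfSubalgebra K A).Quot :=
    sub_mem hz (Subalgebra.algebraMap_mem _ _)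
  have hy0 : Coalgebra.counit (R := K) y = 0 := by simp [hy]
  obtain ⟨f, hf, hfz⟩ := exists_separable_of_D_eq_zero hy'
  obtain ⟨g, hg⟩ := exists_eq_mul_of_separable hf hfz
  have he : IsIdempotentElem (y * Polynomial.aeval y g) := by
    change y * Polynomial.aeval y g * (y * Polynomial.aeval y g) = y * Polynomial.aeval y g
    linear_combination (-Polynomial.aeval y g) * hg
  have hyz : y = 0 := by
    rcases isIdempotentElem_quot he with h | h
    · rw [hg, mul_assoc, h, mul_zero]
    · have := congrArg (Coalgebra.counit (R := K)) h
      rw [Bialgebra.counit_mul, hy0, zero_mul, Bialgebra.counit_one] at this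
      exact absurd this zero_ne_one
  exact Algebra.mem_bot.mpr ⟨_, (sub_eq_zero.mp hyz).symm⟩

theorem separablePart_quot : separablePart K (kaehlerHopfSubalgebra K A).Quot = ⊥ := by
  rw [eq_bot_iff, separablePart, sSup_le_iff]
  rintro S ⟨_, hS⟩
  have : Algebra.Etale K S := hS
  rw [← kaehlerConstants_quot]
  exact le_kaehlerConstants S

theorem isOpenImmersion_mk : AlgebraicGeometry.IsOpenImmersion (AlgebraicGeometry.Spec.map
    (CommRingCat.ofHom (Ideal.Quotient.mk (kaehlerHopfSubalgebra K A).augIdeal))) := by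
  rw [AlgebraicGeometry.isOpenImmersion_SpecMap_iff_of_surjective _ Ideal.Quotient.mk_surjective]
  obtain ⟨e, he, h⟩ := exists_augIdeal_eq_span (K := K) (A := A)
  exact ⟨e, he, Ideal.mk_ker.trans h⟩

theorem preconnectedSpace_of_isIdempotentElem {R : Type*} [CommRing R]
    (h : ∀ e : R, IsIdempotentElem e → e = 0 ∨ e = 1) : PreconnectedSpace (PrimeSpectrum R) := by
  rw [preconnectedSpace_iff_clopen]
  intro s hs
  obtain ⟨e, he, rfl⟩ := PrimeSpectrum.exists_idempotent_basicOpen_eq_of_isClopen hs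
  rcases h e he with rfl | rfl <;> simp

/-- The image is the zero locus of an idempotent, hence open and closed, and it contains the
identity. It is connected because the quotient has only trivial idempotents. -/
theorem range_comap_mk :
    Set.range (PrimeSpectrum.comap (Ideal.Quotient.mk (kaehlerHopfSubalgebra K A).augIdeal)) =
      connectedComponent (identityPoint K A) := by
  obtain ⟨e, he, hspan⟩ := exists_augIdeal_eq_span (K := K) (A := A)
  have hrange := range_comap_of_surjective _
    (Ideal.Quotient.mk (kaehlerHopfSubalgebra K A).augIdeal) Ideal.Quotient.mk_surjective
  have hclopen : IsClopen (Set.range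
      (PrimeSpectrum.comap (Ideal.Quotient.mk (kaehlerHopfSubalgebra K A).augIdeal))) := by
    rw [PrimeSpectrum.isClopen_iff_zeroLocus]
    refine ⟨e, he, ?_⟩
    rw [hrange, Ideal.mk_ker, hspan, PrimeSpectrum.zeroLocus_span]
  have hmem : identityPoint K A ∈ Set.range
      (PrimeSpectrum.comap (Ideal.Quotient.mk (kaehlerHopfSubalgebra K A).augIdeal)) := by
    rw [hrange, Ideal.mk_ker, PrimeSpectrum.mem_zeroLocus]
    intro x hx
    exact counit_eq_zero_of_mem_augIdeal hx
  have := preconnectedSpace_of_isIdempotentElem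
    (fun e he => isIdempotentElem_quot (K := K) (A := A) (x := e) he)
  refine Set.Subset.antisymm ?_ (hclopen.connectedComponent_subset hmem)
  refine IsPreconnected.subset_connectedComponent ?_ hmem
  exact isPreconnected_range (PrimeSpectrum.continuous_comap _)

end Component

/-! ### Lie algebras -/

section Lie

variable {K A : Type*} [Field K] [CommRing A] [HopfAlgebra K A]
  [Differential K] [Differential A] [DifferentialAlgebra K A]

/-- Composition with `A → A/(Z⁺)`, on Lie algebras. -/
def hopfLieQuotHom (Z : DiffHopfSubalgebra K A) : hopfLie K Z.Quot →ₗ⁅K⁆ hopfLie K A where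
  toFun D := ⟨WithConv.toConv (D.1.ofConv ∘ₗ (Ideal.Quotient.mkₐ K Z.augIdeal).toLinearMap),
    fun a b => D.2 (Ideal.Quotient.mk _ a) (Ideal.Quotient.mk _ b)⟩
  map_add' D E := rfl
  map_smul' c D := rfl
  map_lie' {D E} := by
    have key : ∀ (F G : WithConv (Z.Quot →ₗ[K] K)) (a : A),
        (F * G) (Ideal.Quotient.mk Z.augIdeal a) =
        (WithConv.toConv (F.ofConv ∘ₗ (Ideal.Quotient.mkₐ K Z.augIdeal).toLinearMap) *
          WithConv.toConv (G.ofConv ∘ₗ (Ideal.Quotient.mkₐ K Z.augIdeal).toLinearMap)) a := by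
      intro F G a
      rw [LinearMap.convMul_apply, LinearMap.convMul_apply, Bialgebra.Quotient.comul_mk]
      generalize Coalgebra.comul (R := K) a = w
      induction w using TensorProduct.induction_on with
      | zero => simp
      | add x y hx hy => simp only [map_add, hx, hy]
      | tmul a b => rfl
    refine Subtype.ext (WithConv.ofConv_injective (LinearMap.ext fun a => ?_))
    exact congrArg₂ (· - ·) (key D.1 E.1 a) (key E.1 D.1 a)

theorem hopfLieQuotHom_injective (Z : DiffHopfSubalgebra K A) :
    Function.Injective (hopfLieQuotHom Z) := by
  intro D E h
  refine Subtype.ext (WithConv.ofConv_injective (LinearMap.ext fun a => ?_))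
  obtain ⟨a, rfl⟩ := Ideal.Quotient.mk_surjective a
  exact congrArg (fun F : hopfLie K A => F.1 a) h

/-- The ideal is generated by an idempotent `e` with `ε(e) = 0`. Hence `D(e) = D(e²) = 2ε(e)D(e) =
0`, so `D` kills the ideal and factors through the quotient. -/
theorem hopfLieQuotHom_surjective [CharZero K] [Algebra.FiniteType K A] :
    Function.Surjective (hopfLieQuotHom (kaehlerHopfSubalgebra K A)) := by
  intro D
  obtain ⟨e, he, hspan⟩ := exists_augIdeal_eq_span (K := K) (A := A)
  have hεe : Coalgebra.counit (R := K) e = 0 :=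
    counit_eq_zero_of_mem_augIdeal (Z := kaehlerHopfSubalgebra K A)
      (hspan ▸ Ideal.mem_span_singleton_self e)
  have hDe : D.1 e = 0 := by
    have h := D.2 e e
    rwa [he.eq, hεe, mul_zero, zero_mul, add_zero] at h
  have hD : ∀ x ∈ (kaehlerHopfSubalgebra K A).augIdeal, D.1 x = 0 := by
    intro x hx
    rw [hspan, Ideal.mem_span_singleton] at hx
    obtain ⟨c, rfl⟩ := hx
    rw [D.2, hDe, hεe, zero_mul, zero_mul, add_zero]
  refine ⟨⟨WithConv.toConv (Submodule.liftQ
    ((kaehlerHopfSubalgebra K A).augIdeal.restrictScalars K) D.1.ofConv hD), ?_⟩, ?_⟩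
  · intro a b
    obtain ⟨a, rfl⟩ := Ideal.Quotient.mk_surjective a
    obtain ⟨b, rfl⟩ := Ideal.Quotient.mk_surjective b
    exact D.2 a b
  · rfl

end Lie

/-! ### Finite type, and its descent along the torsor -/

instance finiteType_semidirectCoord {k Γ J : Type*} [CommRing k] [Group Γ] [Finite Γ] [CommRing J]
    [HopfAlgebra k J] [Algebra.FiniteType k J] (φ : HopfAction k Γ J) :
    Algebra.FiniteType k (SemidirectCoord φ) :=
  have : Algebra.FiniteType k (Γ → J) := Algebra.FiniteType.trans (S := J) inferInstance inferInstance
  this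

/-- If `Spec B` is a bi-torsor for `Spec H'` and `Spec H`, and `H` is of finite type, then so is
`H'`. -/
theorem finiteType_of_isBiGalois {K B H H' : Type*} [Field K] [Differential K]
    [CommRing B] [Algebra K B] [Differential B] [DifferentialAlgebra K B]
    [CommRing H] [HopfAlgebra K H] [Differential H] [DifferentialAlgebra K H] [DiffHopfAlgebra K H]
    [CommRing H'] [HopfAlgebra K H'] [Differential H'] [DifferentialAlgebra K H']
    [DiffHopfAlgebra K H'] [Algebra.FiniteType K H] {lam : B →ₐ[K] H' ⊗[K] B}
    {ρ : B →ₐ[K] B ⊗[K] H} (hB : IsBiGalois K lam ρ) : Algebra.FiniteType K H' := by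
  have : Nontrivial B := hB.left.nontrivial
  let R : B ⊗[K] B ≃+* B ⊗[K] H := RingEquiv.ofBijective (rightGaloisMap K ρ) hB.right.bijective
  have hR : ∀ b, R.symm (algebraMap B _ b) = algebraMap B _ b := fun b => by
    rw [RingEquiv.symm_apply_eq]
    change _ = rightGaloisMap K ρ (b ⊗ₜ 1)
    simp [rightGaloisMap]
  -- The right Galois map is linear over the first factor `B`, the left one over the second. The two
  -- swaps put the factor `B` on the left throughout, so that the composite `F` is `B`-linear.
  let L : B ⊗[K] B →+* B ⊗[K] H' :=
    ((Algebra.TensorProduct.comm K H' B).toAlgHom.comp ((leftGaloisMap K lam).comp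
      (Algebra.TensorProduct.comm K B B).toAlgHom)).toRingHom
  have hL : ∀ b, L (algebraMap B _ b) = algebraMap B _ b := fun b => by
    change Algebra.TensorProduct.comm K H' B (leftGaloisMap K lam
      (Algebra.TensorProduct.comm K B B (b ⊗ₜ 1))) = b ⊗ₜ 1
    simp [leftGaloisMap]
  have hLsurj : Function.Surjective L :=
    (Algebra.TensorProduct.comm K H' B).surjective.comp (hB.left.bijective.surjective.comp
      (Algebra.TensorProduct.comm K B B).surjective)
  let F : B ⊗[K] H →ₐ[B] B ⊗[K] H' :=
    { L.comp R.symm.toRingHom with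
      commutes' := fun b => (congrArg L (hR b)).trans (hL b) }
  have : Algebra.FiniteType B (B ⊗[K] H') :=
    Algebra.FiniteType.of_surjective F (hLsurj.comp R.symm.surjective)
  -- A nonzero algebra over a field is faithfully flat.
  exact Algebra.FiniteType.of_finiteType_tensorProduct_of_faithfullyFlat (T := B)

end DiffTorsor

end
theorem mainTheorem7
    {K : Type*} [Field K] [Differential K] [Algebra ℂ K] [ConstantBase ℂ K]
    {J₀ : Type*} [CommRing J₀] [HopfAlgebra ℂ J₀] [Algebra.FiniteType ℂ J₀]
    [ConnectedSpace (PrimeSpectrum J₀)]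
    {Γ : Type*} [Group Γ] [Fintype Γ] [DecidableEq Γ] (φ : HopfAction ℂ Γ J₀)
    {B : Type*} [CommRing B] [Algebra K B] [Differential B] [DifferentialAlgebra K B]
    (ρ : B →ₐ[K] B ⊗[K] (K ⊗[ℂ] SemidirectCoord φ))
    {H' : Type*} [CommRing H'] [HopfAlgebra K H'] [Differential H'] [DifferentialAlgebra K H']
    [DiffHopfAlgebra K H'] (lam : B →ₐ[K] H' ⊗[K] B) (hB : IsBiGalois K lam ρ) :
    ∃ Z' : DiffHopfSubalgebra K H',
      IsFiniteSeparable K Z'.toSubalgebra ∧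
      separablePart K Z'.Quot = ⊥ ∧
      AlgebraicGeometry.IsOpenImmersion (AlgebraicGeometry.Spec.map
        (CommRingCat.ofHom (Ideal.Quotient.mk Z'.augIdeal))) ∧
      Set.range (PrimeSpectrum.comap (Ideal.Quotient.mk Z'.augIdeal)) =
        connectedComponent (identityPoint K H') ∧
      ∃ e : hopfLie K Z'.Quot ≃ₗ⁅K⁆ hopfLie K H',
        (∀ (D : hopfLie K Z'.Quot) (h : H'),
          (e D).1 h = D.1 (Ideal.Quotient.mk Z'.augIdeal h)) ∧
        ∀ D : hopfLie K Z'.Quot, e (hopfLieDeriv D) = hopfLieDeriv (e D) := by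
  have : CharZero K := charZero_of_injective_algebraMap (algebraMap ℂ K).injective
  have : Algebra.FiniteType K H' := finiteType_of_isBiGalois hB
  refine ⟨kaehlerHopfSubalgebra K H', isFiniteSeparable_kaehlerConstants, separablePart_quot,
    isOpenImmersion_mk, range_comap_mk,
    LieEquiv.ofBijective (hopfLieQuotHom _) ⟨hopfLieQuotHom_injective _, hopfLieQuotHom_surjective⟩,
    fun D h => rfl, fun D => rfl⟩
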